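/- Let $\mathbb K$ be $\mathbb R$ or $\mathbb C$; all normed spaces are over $\mathbb K$. A normed space is strictly convex if every point of its unit sphere is an extreme point of its closed unit ball. For $\varepsilon>0$, a norm $|||\cdot|||$ on a normed space $(Y,\|\cdot\|)$ is called $\varepsilon$-equivalent to $\|\cdot\|$ if $\frac{1}{1+\varepsilon}\|y\|\le |||y|||\le(1+\varepsilon)\|y\|$ for all $y\in Y$. A property $\mathcal P$ of (not necessarily complete) normed spaces, invariant under linear isometric isomorphism, is called a stable C-property if $C[0,1]$ (the space of continuous functions $[0,1]\to\mathbb K$ with the supremum norm) has $\mathcal P$, and every normed space $X$ satisfying the following condition has $\mathcal P$: for every $\varepsilon>0$ and every finite set $F\subset X$ there are a linear subspace $Y\subset X$ with $F\subset Y$ and a norm $\|\cdot\|_\varepsilon$ on $Y$, $\varepsilon$-equivalent to the norm inherited from $X$, such that $(Y,\|\cdot\|_\varepsilon)$ has $\mathcal P$. For a normed space $X$, let $B_X$ and $S_X$ denote its closed unit ball and unit sphere, and $X^*$ its dual. $X$ is lush if for all $x,y\in S_X$ and every $\varepsilon>0$ there is $x^*\in S_{X^*}$ such that the slice $S=\{z\in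 B_X:\operatorname{Re}x^*(z)>1-\varepsilon\}$ contains $x$ and $\operatorname{dist}(y,\operatorname{aco}(S))<\varepsilon$, where $\operatorname{aco}(S)$ is the absolutely convex hull of $S$. The numerical index of $X$ is $$n(X)=\inf\{v(T): T\in L(X),\ \|T\|=1\},\qquad v(T)=\sup\{|x^*(Tx)|: x\in S_X,\ x^*\in S_{X^*},\ x^*(x)=1\},$$ where $L(X)$ is the space of bounded linear operators on $X$. **Theorem.** For every strictly convex separable Banach space $Y_0$ there is a strictly convex, separable, non-complete normed space $X$ which contains $Y_0$ (up to a linear isometric embedding) and has every stable C-property. In particular, $X$ is lush and $n(X)=1$; thus there are strictly convex normed spaces which are lush. -/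

import Mathlib

universe u

noncomputable section

namespace NormedGeom

/-! ### Strict convexity -/

/-- A normed space over `𝕜` (`ℝ` or `ℂ`) is strictly convex if its closed balls are strictly convex
as sets in the underlying real normed space. For a nonzero space this says that every point of the
unit sphere is an extreme point of the closed unit ball. -/
def IsStrictlyConvex (𝕜 : Type*) [RCLike 𝕜] (X : Type*) [NormedAddCommGroup X]
    [NormedSpace 𝕜 X] : Prop :=
  letI : NormedSpace ℝ X := NormedSpace.restrictScalars ℝ 𝕜 X
  StrictConvexSpace ℝ X

/-! ### Norms on a linear space, renormed spaces -/

/-- A norm on the linear space `E`, as a function. -/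
structure LinearNorm (𝕜 : Type*) [RCLike 𝕜] (E : Type*) [AddCommGroup E] [Module 𝕜 E]
    extends Seminorm 𝕜 E where
  eq_zero_of_map_eq_zero : ∀ x, toFun x = 0 → x = 0

/-- The linear space `E` endowed with the norm `p`. -/
def WithNorm {𝕜 : Type*} [RCLike 𝕜] {E : Type*} [AddCommGroup E] [Module 𝕜 E]
    (_p : LinearNorm 𝕜 E) : Type _ := E

namespace WithNorm

variable {𝕜 : Type*} [RCLike 𝕜] {E : Type*} [AddCommGroup E] [Module 𝕜 E]
  (p : LinearNorm 𝕜 E)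

instance : AddCommGroup (WithNorm p) := inferInstanceAs (AddCommGroup E)

instance : Module 𝕜 (WithNorm p) := inferInstanceAs (Module 𝕜 E)

/-- The norm of `WithNorm p` is `p`. -/
instance : Norm (WithNorm p) := ⟨fun x => p.toSeminorm x⟩

theorem core : NormedSpace.Core 𝕜 (WithNorm p) where
  norm_nonneg x := apply_nonneg p.toSeminorm x
  norm_smul c x := map_smul_eq_mul p.toSeminorm c x
  norm_triangle x y := map_add_le_add p.toSeminorm x y
  norm_eq_zero_iff x :=
    ⟨fun h => p.eq_zero_of_map_eq_zero x h, fun h => by subst h; exact map_zero p.toSeminorm⟩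

instance : NormedAddCommGroup (WithNorm p) := NormedAddCommGroup.ofCore (core p)

instance : NormedSpace 𝕜 (WithNorm p) := NormedSpace.ofCore (core p)

end WithNorm

/-- The norm `p` is `ε`-equivalent to the given norm of `E`:
`(1 + ε)⁻¹ ‖x‖ ≤ p x ≤ (1 + ε) ‖x‖` for all `x`. -/
def LinearNorm.IsEpsEquivalent {𝕜 : Type*} [RCLike 𝕜] {E : Type*} [NormedAddCommGroup E]
    [NormedSpace 𝕜 E] (p : LinearNorm 𝕜 E) (ε : ℝ) : Prop :=
  ∀ x : E, 1 / (1 + ε) * ‖x‖ ≤ p.toSeminorm x ∧ p.toSeminorm x ≤ (1 + ε) * ‖x‖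

/-! ### Stable C-properties -/

/-- A property of (not necessarily complete) normed spaces over `𝕜`, that is, a predicate that does
not distinguish between isometrically isomorphic spaces. -/
structure SpaceProperty (𝕜 : Type) [RCLike 𝕜] where
  /-- `P.Holds X` says that `X` has the property `P`. -/
  Holds : ∀ (X : Type u) [NormedAddCommGroup X] [NormedSpace 𝕜 X], Prop
  of_isometry : ∀ (X Z : Type u) [NormedAddCommGroup X] [NormedSpace 𝕜 X]
    [NormedAddCommGroup Z] [NormedSpace 𝕜 Z], (X ≃ₗᵢ[𝕜] Z) → Holds X → Holds Z

/-- `P` is a stable C-property: `C[0,1]` has `P`, and a normed space `X` has `P` as soon as, for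
every `ε > 0`, every finite subset of `X` lies in a linear subspace `Y` that possesses an
`ε`-equivalent norm with which it has `P`. -/
structure SpaceProperty.IsStableC {𝕜 : Type} [RCLike 𝕜] (P : SpaceProperty.{u} 𝕜) : Prop where
  holds_C : P.Holds (ULift.{u} C(unitInterval, 𝕜))
  stable : ∀ (X : Type u) [NormedAddCommGroup X] [NormedSpace 𝕜 X],
    (∀ ε : ℝ, 0 < ε → ∀ F : Finset X, ∃ Y : Submodule 𝕜 X, (F : Set X) ⊆ Y ∧
      ∃ p : LinearNorm 𝕜 Y, p.IsEpsEquivalent ε ∧ P.Holds (WithNorm p)) →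
    P.Holds X

/-! ### Lushness -/

/-- The slice `S(f, ε) = {z ∈ B_X : Re f(z) > 1 - ε}` of the closed unit ball. -/
def slice {𝕜 : Type*} [RCLike 𝕜] {X : Type*} [NormedAddCommGroup X] [NormedSpace 𝕜 X]
    (f : X →L[𝕜] 𝕜) (ε : ℝ) : Set X :=
  {z | ‖z‖ ≤ 1 ∧ 1 - ε < RCLike.re (f z)}

open scoped ComplexOrder in
/-- `X` is lush: for all `x, y ∈ S_X` and `ε > 0` there is a slice `S = S(f, ε)` with `‖f‖ = 1`,
`x ∈ S` and `dist (y, aco S) < ε`. (The order on `𝕜` is the one for which the scalars `≥ 0` are the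
nonnegative reals, so that `absConvexHull 𝕜` is the usual absolutely convex hull.) -/
def IsLush (𝕜 : Type*) [RCLike 𝕜] (X : Type*) [NormedAddCommGroup X] [NormedSpace 𝕜 X] : Prop :=
  ∀ x y : X, ‖x‖ = 1 → ‖y‖ = 1 → ∀ ε : ℝ, 0 < ε →
    ∃ f : X →L[𝕜] 𝕜, ‖f‖ = 1 ∧ x ∈ slice f ε ∧
      Metric.infDist y (absConvexHull 𝕜 (slice f ε)) < ε

/-! ### Numerical index -/

/-- The numerical range `V(T) = {f (T x) : ‖f‖ = ‖x‖ = f x = 1}` of a bounded operator. -/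
def numericalRange {𝕜 : Type*} [RCLike 𝕜] {X : Type*} [NormedAddCommGroup X] [NormedSpace 𝕜 X]
    (T : X →L[𝕜] X) : Set 𝕜 :=
  {c | ∃ (x : X) (f : X →L[𝕜] 𝕜), ‖x‖ = 1 ∧ ‖f‖ = 1 ∧ f x = 1 ∧ c = f (T x)}

/-- The numerical radius `v(T) = sup {|c| : c ∈ V(T)}`. -/
def numericalRadius {𝕜 : Type*} [RCLike 𝕜] {X : Type*} [NormedAddCommGroup X] [NormedSpace 𝕜 X]
    (T : X →L[𝕜] X) : ℝ :=
  sSup ((fun c : 𝕜 => ‖c‖) '' numericalRange T)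

/-- The numerical index `n(X) = inf {v(T) : ‖T‖ = 1}`. -/
def numericalIndex (𝕜 : Type*) [RCLike 𝕜] (X : Type*) [NormedAddCommGroup X]
    [NormedSpace 𝕜 X] : ℝ :=
  sInf {r | ∃ T : X →L[𝕜] X, ‖T‖ = 1 ∧ r = numericalRadius T}

end NormedGeom

end

noncomputable section

open MeasureTheory Set Filter Topology

namespace NormedGeom

/-! The space `X` is the union of an increasing chain of strictly convex Banach spaces, each of
which is linearly `C[0,1]` under a norm that lies within a factor `1 + 1/(n+1)` of the supremum
norm. Strict convexity concerns two points at a time, so it passes to the union. A finite subset of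
`X` lies in arbitrarily late members of the chain, hence in subspaces almost isometric to `C[0,1]`;
this gives every stable C-property. Each inclusion is proper, so Baire's theorem rules out
completeness.

The chain rests on one extension step (`exists_rotundNorm_extension`). By Banach–Mazur
(`exists_isometry_unitInterval`) a strictly convex separable Banach space is a closed subspace `K`
of `C[0,1]`. The norm of `C[0,1]` is then replaced by a gauge of the three quantities `‖x‖`, `d(x,
K)` and `‖T x‖`, where `T` is the injection into `L²` (`exists_strictlyConvex_extension`). On `K`
the second quantity vanishes and the norm is unchanged; off `K` the strict convexity of `L²` makes
the norm strictly convex. The convexity estimate behind this is `bendFun_combo_le`.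

Lushness is checked directly (`isLush_of_locally_unitInterval`): in `C[0,1]` the functional is
evaluation at a point where the first function attains its norm. The numerical index then follows
from lushness through Lumer's estimate `one_sub_mul_norm_le`, which needs no completeness and
replaces the usual perturbation to norm-attaining functionals. -/

/-! ### The Banach–Mazur theorem -/

/-- The Cantor space embeds in `[0, 1]` in such a way that all its coordinate functions extend. -/
theorem exists_unitInterval_coordinates :
    ∃ (ι : (ℕ → Bool) → unitInterval) (h : ℕ → C(unitInterval, ℝ)),
      ∀ s n, h n (ι s) = if s n then 1 else 0 := by
  let ι : (ℕ → Bool) → unitInterval := fun s =>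
    ⟨cantorSetHomeomorphNatToBool.symm s,
      cantorSet_subset_unitInterval (cantorSetHomeomorphNatToBool.symm s).2⟩
  have hcont : Continuous ι :=
    Continuous.subtype_mk (continuous_subtype_val.comp
      cantorSetHomeomorphNatToBool.symm.continuous) _
  have hinj : Function.Injective ι := fun s t hst =>
    cantorSetHomeomorphNatToBool.symm.injective
      (Subtype.ext (congrArg (fun x : unitInterval => (x : ℝ)) hst))
  have hemb : IsClosedEmbedding ι := hcont.isClosedEmbedding hinj
  let bit : ℕ → C(ℕ → Bool, ℝ) := fun n =>
    ⟨fun s => if s n then 1 else 0,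
      (continuous_of_discreteTopology (f := fun b : Bool => if b then (1 : ℝ) else 0)).comp
        (continuous_apply n)⟩
  choose h hh using fun n => ContinuousMap.exists_extension hemb (bit n)
  exact ⟨ι, h, fun s n => DFunLike.congr_fun (hh n) s⟩

/-- The `0`-`1` sequence obtained from a real sequence by comparing it with the level `t`. -/
def levelBits (a : ℕ → ℝ) (t : ℝ) : ℕ → Bool := fun n => decide (t < a n)

theorem measurable_levelBits (a : ℕ → ℝ) : Measurable (levelBits a) := by
  refine measurable_pi_iff.2 fun n => ?_
  exact measurable_to_bool (by
    have : (fun t => levelBits a t n) ⁻¹' {true} = Iio (a n) := by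
      ext t; simp [levelBits]
    rw [this]; exact measurableSet_Iio)

/-- If `t` avoids all the values `h n x₀`, then each strict comparison persists near `x₀`, so each
bit is locally constant there. -/
theorem tendsto_levelBits {X : Type*} [TopologicalSpace X] (h : ℕ → C(X, ℝ)) (x₀ : X) (t : ℝ)
    (ht : ∀ n, t ≠ h n x₀) :
    Tendsto (fun x => levelBits (fun n => h n x) t) (𝓝 x₀)
      (𝓝 (levelBits (fun n => h n x₀) t)) := by
  refine tendsto_pi_nhds.2 fun n => ?_
  refine tendsto_nhds_of_eventually_eq ?_
  rcases lt_or_gt_of_ne (ht n) with hlt | hlt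
  · filter_upwards [(h n).continuous.continuousAt.eventually (lt_mem_nhds hlt)] with x hx
    simp [levelBits, hx, hlt]
  · filter_upwards [(h n).continuous.continuousAt.eventually (gt_mem_nhds hlt)] with x hx
    simp [levelBits, not_lt_of_gt hx, not_lt_of_gt hlt]

/-- A simultaneous extension operator from the Cantor set to `[0, 1]`. -/
theorem exists_isometry_cantor_unitInterval (𝕜 : Type*) [RCLike 𝕜] :
    Nonempty (C(ℕ → Bool, 𝕜) →ₗᵢ[𝕜] C(unitInterval, 𝕜)) := by
  obtain ⟨ι, h, hι⟩ := exists_unitInterval_coordinates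
  let μ : Measure ℝ := volume.restrict (Ico 0 1)
  have hμ : IsProbabilityMeasure μ := ⟨by simp [μ]⟩
  -- Averaging `f` over the level `t` smooths the jumps of the bits in `x`: for each `x₀` only
  -- countably many levels are bad.
  let F : C(ℕ → Bool, 𝕜) → unitInterval → ℝ → 𝕜 := fun f x t =>
    f (levelBits (fun n => h n x) t)
  have hmeas : ∀ f x, AEStronglyMeasurable (F f x) μ := fun f x =>
    (f.continuous.measurable.comp (measurable_levelBits _)).aestronglyMeasurable
  have hint : ∀ f x, Integrable (F f x) μ := fun f x =>
    Integrable.of_bound (hmeas f x) ‖f‖ (Eventually.of_forall fun t => f.norm_coe_le_norm _)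
  have hcont : ∀ f, Continuous fun x => ∫ t, F f x t ∂μ := by
    intro f
    refine continuous_iff_continuousAt.2 fun x₀ => ?_
    refine tendsto_integral_filter_of_dominated_convergence (fun _ => ‖f‖)
      (Eventually.of_forall (hmeas f))
      (Eventually.of_forall fun x => Eventually.of_forall fun t => f.norm_coe_le_norm _)
      (integrable_const _) ?_
    have hcount : (range fun n => h n x₀).Countable := countable_range _
    filter_upwards [hcount.ae_notMem μ] with t ht
    exact (f.continuous.tendsto _).comp
      (tendsto_levelBits h x₀ t fun n hn => ht ⟨n, hn.symm⟩)
  let E : C(ℕ → Bool, 𝕜) →ₗ[𝕜] C(unitInterval, 𝕜) :=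
    { toFun := fun f => ⟨fun x => ∫ t, F f x t ∂μ, hcont f⟩
      map_add' := fun f g => by
        ext x
        exact integral_add (hint f x) (hint g x)
      map_smul' := fun c f => by
        ext x
        exact integral_smul c (F f x) }
  have hE : ∀ f s, E f (ι s) = f s := by
    intro f s
    have hae : F f (ι s) =ᵐ[μ] fun _ => f s := by
      filter_upwards [ae_restrict_mem measurableSet_Ico] with t ht
      -- At `ι s` the values are `0` or `1`, and for `0 ≤ t < 1` the test `t < h n` returns exactly
      -- the bits of `s`.
      have : levelBits (fun n => h n (ι s)) t = s := by
        ext n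
        cases hs : s n <;> simp [levelBits, hι, hs, ht.1, ht.2]
      simp only [F, this]
    change ∫ t, F f (ι s) t ∂μ = f s
    rw [integral_congr_ae hae]
    simp
  refine ⟨⟨E, fun f => le_antisymm ?_ ?_⟩⟩
  · refine (ContinuousMap.norm_le _ (norm_nonneg f)).2 fun x => ?_
    have := norm_integral_le_of_norm_le_const (μ := μ) (f := F f x) (C := ‖f‖)
      (Eventually.of_forall fun t => f.norm_coe_le_norm _)
    rw [probReal_univ, mul_one] at this
    exact this
  · refine (ContinuousMap.norm_le _ (norm_nonneg _)).2 fun s => ?_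
    rw [← hE f s]
    exact (E f).norm_coe_le_norm _

/-- Every separable normed space embeds isometrically into `C[0, 1]`. -/
theorem exists_isometry_unitInterval (𝕜 : Type*) [RCLike 𝕜] (Y : Type*) [NormedAddCommGroup Y]
    [NormedSpace 𝕜 Y] [TopologicalSpace.SeparableSpace Y] :
    Nonempty (Y →ₗᵢ[𝕜] C(unitInterval, 𝕜)) := by
  -- The dual ball is weak-star compact, and metrizable since `Y` is separable; hence it is a
  -- continuous image of the Cantor space.
  let K : Set (WeakDual 𝕜 Y) := WeakDual.toStrongDual ⁻¹' Metric.closedBall 0 1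
  have hK : IsCompact K := WeakDual.isCompact_closedBall 0 1
  have : CompactSpace K := isCompact_iff_compactSpace.1 hK
  have : TopologicalSpace.MetrizableSpace K := WeakDual.metrizable_of_isCompact 𝕜 Y K hK
  let : MetricSpace K := TopologicalSpace.metrizableSpaceMetric K
  have : Nonempty K := ⟨⟨0, by simp [K]⟩⟩
  obtain ⟨φ, hφ, hsurj⟩ := exists_nat_bool_continuous_surjective_of_compact K
  let R : Y →ₗ[𝕜] C(ℕ → Bool, 𝕜) :=
    { toFun := fun y => ⟨fun s => (φ s : WeakDual 𝕜 Y) y,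
        (WeakDual.eval_continuous y).comp (continuous_subtype_val.comp hφ)⟩
      map_add' := fun y z => by ext s; simp
      map_smul' := fun c y => by ext s; simp }
  have hR : ∀ y, ‖R y‖ = ‖y‖ := by
    intro y
    refine le_antisymm ((ContinuousMap.norm_le _ (norm_nonneg y)).2 fun s => ?_) ?_
    · have h1 : ‖WeakDual.toStrongDual (φ s : WeakDual 𝕜 Y)‖ ≤ 1 :=
        mem_closedBall_zero_iff.1 (φ s).2
      exact ((WeakDual.toStrongDual (φ s : WeakDual 𝕜 Y)).le_of_opNorm_le h1 y).trans
        (one_mul _).le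
    · obtain ⟨g, hg, hgy⟩ := exists_dual_vector'' 𝕜 y
      obtain ⟨s, hs⟩ := hsurj ⟨StrongDual.toWeakDual g, by simpa [K] using hg⟩
      have h1 : R y s = ‖y‖ := by
        change (φ s : WeakDual 𝕜 Y) y = _
        rw [hs]; exact hgy
      have h2 := (R y).norm_coe_le_norm s
      rwa [h1, RCLike.norm_ofReal, abs_norm] at h2
  obtain ⟨E⟩ := exists_isometry_cantor_unitInterval 𝕜
  exact ⟨E.comp ⟨R, hR⟩⟩

end NormedGeom
end

noncomputable section

open Filter Topology

namespace NormedGeom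

/-! ### Strict convexity of norms over `ℝ` or `ℂ` -/

theorem isStrictlyConvex_of_norm_add_ne_two {𝕜 : Type*} [RCLike 𝕜] {X : Type*}
    [NormedAddCommGroup X] [NormedSpace 𝕜 X]
    (h : ∀ x y : X, ‖x‖ = 1 → ‖y‖ = 1 → ‖x + y‖ = 2 → x = y) : IsStrictlyConvex 𝕜 X := by
  let : NormedSpace ℝ X := NormedSpace.restrictScalars ℝ 𝕜 X
  exact StrictConvexSpace.of_norm_add_ne_two fun x y hx hy hne h2 => hne (h x y hx hy h2)

theorem IsStrictlyConvex.eq_of_norm_add {𝕜 : Type*} [RCLike 𝕜] {X : Type*}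
    [NormedAddCommGroup X] [NormedSpace 𝕜 X] (h : IsStrictlyConvex 𝕜 X) {x y : X}
    (hxy : ‖x‖ = ‖y‖) (hadd : ‖x + y‖ = ‖x‖ + ‖y‖) : x = y := by
  let : NormedSpace ℝ X := NormedSpace.restrictScalars ℝ 𝕜 X
  have : StrictConvexSpace ℝ X := h
  exact eq_of_norm_eq_of_norm_add_eq hxy hadd

/-! ### A gauge function of three variables -/

/-- The function `a² + δ b² (1 + c² / 8)`, which is convex on `0 ≤ b, c ≤ 1`. -/
def bendFun (δ a b c : ℝ) : ℝ := a ^ 2 + δ * b ^ 2 * (1 + c ^ 2 / 8)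

/-- The gauge of the set where `bendFun δ` is at most `1`. -/
def bendGauge (δ a b c : ℝ) : ℝ :=
  √(((a ^ 2 + δ * b ^ 2) + √((a ^ 2 + δ * b ^ 2) ^ 2 + 4 * (δ * b ^ 2 * c ^ 2 / 8))) / 2)

section bend

variable {δ a b c a' b' c' : ℝ}

theorem bendGauge_nonneg : 0 ≤ bendGauge δ a b c := Real.sqrt_nonneg _

theorem bendGauge_zero_mid : bendGauge δ a 0 c = |a| := by
  have h : √((a ^ 2) ^ 2) = a ^ 2 := Real.sqrt_sq (sq_nonneg a)
  rw [← Real.sqrt_sq_eq_abs, bendGauge]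
  congr 1
  simp [h]

theorem bendGauge_smul {r : ℝ} (hr : 0 ≤ r) :
    bendGauge δ (r * a) (r * b) (r * c) = r * bendGauge δ a b c := by
  have h : ((r * a) ^ 2 + δ * (r * b) ^ 2) ^ 2 + 4 * (δ * (r * b) ^ 2 * (r * c) ^ 2 / 8) =
      (r ^ 2) ^ 2 * ((a ^ 2 + δ * b ^ 2) ^ 2 + 4 * (δ * b ^ 2 * c ^ 2 / 8)) := by ring
  rw [bendGauge, bendGauge, h, Real.sqrt_mul (by positivity), Real.sqrt_sq (by positivity)]
  nth_rewrite 4 [← Real.sqrt_sq hr]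
  rw [← Real.sqrt_mul (by positivity)]
  congr 1
  ring

/-- With `A = a² + δb²` and `B = δb²c²/8`, the square of the gauge is the larger root of `r² = A r +
B`, and this root is at most `1` exactly when `A + B ≤ 1`. -/
theorem bendGauge_le_one_iff (hδ : 0 ≤ δ) : bendGauge δ a b c ≤ 1 ↔ bendFun δ a b c ≤ 1 := by
  have hA : 0 ≤ a ^ 2 + δ * b ^ 2 := by positivity
  have hB : 0 ≤ δ * b ^ 2 * c ^ 2 / 8 := by positivity
  have hF : bendFun δ a b c = (a ^ 2 + δ * b ^ 2) + δ * b ^ 2 * c ^ 2 / 8 := by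
    rw [bendFun]; ring
  rw [hF, bendGauge]
  generalize a ^ 2 + δ * b ^ 2 = A at *
  generalize δ * b ^ 2 * c ^ 2 / 8 = B at *
  rw [Real.sqrt_le_one, div_le_one two_pos, ← le_sub_iff_add_le', Real.sqrt_le_iff]
  constructor
  · rintro ⟨_, h⟩; nlinarith
  · intro h; exact ⟨by linarith, by nlinarith⟩

theorem bendGauge_mono (hδ : 0 ≤ δ) (ha : 0 ≤ a) (hb : 0 ≤ b) (hc : 0 ≤ c) (haa : a ≤ a')
    (hbb : b ≤ b') (hcc : c ≤ c') : bendGauge δ a b c ≤ bendGauge δ a' b' c' := by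
  unfold bendGauge
  gcongr

theorem le_bendGauge (hδ : 0 ≤ δ) : a ≤ bendGauge δ a b c := by
  have h1 : a ^ 2 + δ * b ^ 2 ≤
      √((a ^ 2 + δ * b ^ 2) ^ 2 + 4 * (δ * b ^ 2 * c ^ 2 / 8)) := by
    apply Real.le_sqrt_of_sq_le
    have : 0 ≤ δ * b ^ 2 * c ^ 2 / 8 := by positivity
    linarith
  have h2 : 0 ≤ δ * b ^ 2 := by positivity
  apply Real.le_sqrt_of_sq_le
  linarith

theorem bendGauge_le (hδ : 0 ≤ δ) (hb : 0 ≤ b) (hc : 0 ≤ c) (hba : b ≤ a) (hca : c ≤ a) :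
    bendGauge δ a b c ≤ (1 + δ) * a := by
  have ha : 0 ≤ a := hb.trans hba
  have hbb : b ^ 2 ≤ a ^ 2 := by gcongr
  have hcc : c ^ 2 ≤ a ^ 2 := by gcongr
  have h1 : δ * b ^ 2 ≤ δ * a ^ 2 := by gcongr
  have h2 : δ * b ^ 2 * c ^ 2 ≤ δ * a ^ 2 * a ^ 2 := by gcongr
  have h0 : 0 ≤ δ * b ^ 2 := by positivity
  have h3 : √((a ^ 2 + δ * b ^ 2) ^ 2 + 4 * (δ * b ^ 2 * c ^ 2 / 8)) ≤ (1 + 2 * δ) * a ^ 2 := by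
    rw [Real.sqrt_le_iff]
    refine ⟨by positivity, ?_⟩
    have h4 : (a ^ 2 + δ * b ^ 2) ^ 2 ≤ (a ^ 2 + δ * a ^ 2) ^ 2 := by gcongr
    have h5 : 0 ≤ δ * (a ^ 2 * a ^ 2) := by positivity
    have h6 : 0 ≤ δ ^ 2 * (a ^ 2 * a ^ 2) := by positivity
    nlinarith
  rw [bendGauge, Real.sqrt_le_iff]
  refine ⟨by positivity, ?_⟩
  have : 0 ≤ δ ^ 2 * a ^ 2 := by positivity
  have : 0 ≤ δ * a ^ 2 := by positivity
  nlinarith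

/-- The defect of convexity of `bendFun`. -/
theorem bendFun_combo_le {l m : ℝ} (hδ : 0 ≤ δ) (hl : 0 ≤ l) (hm : 0 ≤ m) (hlm : l + m = 1)
    (hc : 0 ≤ c) (hc1 : c ≤ 1) (hc' : 0 ≤ c') (hc1' : c' ≤ 1) :
    bendFun δ (l * a + m * a') (l * b + m * b') (l * c + m * c') +
      δ * (l * m) * (5 / 8 * (b - b') ^ 2 +
        (b * c - b' * c' + (l * c + m * c') * (b - b')) ^ 2 / 8) ≤
      l * bendFun δ a b c + m * bendFun δ a' b' c' := by
  obtain rfl : l = 1 - m := by linarith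
  set C := (1 - m) * c + m * c' with hC
  set D := m * c + (1 - m) * c' with hD
  have hC0 : 0 ≤ C := by positivity
  have hC1 : C ≤ 1 := by nlinarith
  have hD0 : 0 ≤ D := by positivity
  have hD1 : D ≤ 1 := by nlinarith
  have hCC : C ^ 2 ≤ 1 := by nlinarith
  have hCD : C * D ≤ 1 := by nlinarith
  have h1 : 0 ≤ 3 - C ^ 2 - 2 * (C * D) + (1 - m) * m * (c - c') ^ 2 := by
    have : 0 ≤ (1 - m) * m * (c - c') ^ 2 := by positivity
    linarith
  have h2 : 0 ≤ δ * ((1 - m) * m) * (b - b') ^ 2 *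
      (3 - C ^ 2 - 2 * (C * D) + (1 - m) * m * (c - c') ^ 2) := by positivity
  have h3 : 0 ≤ (1 - m) * m * (a - a') ^ 2 := by positivity
  -- Of the defect `(b - b')²` of the term `b²`, a share `3/8` absorbs the indefinite cross term of
  -- `b²c²/8`, since `C, D ∈ [0, 1]`. What is kept forces `b = b'` and then `b (c - c') = 0` in the
  -- equality case.
  have key : (1 - m) * bendFun δ a b c + m * bendFun δ a' b' c' -
      (bendFun δ ((1 - m) * a + m * a') ((1 - m) * b + m * b') C +
      δ * ((1 - m) * m) * (5 / 8 * (b - b') ^ 2 +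
        (b * c - b' * c' + C * (b - b')) ^ 2 / 8)) = (1 - m) * m * (a - a') ^ 2 +
      δ * ((1 - m) * m) * (b - b') ^ 2 *
      (3 - C ^ 2 - 2 * (C * D) + (1 - m) * m * (c - c') ^ 2) / 8 := by
    simp only [hC, hD, bendFun]
    ring
  linarith

theorem bendFun_mono (hδ : 0 ≤ δ) (ha : 0 ≤ a) (hb : 0 ≤ b) (hc : 0 ≤ c) (haa : a ≤ a')
    (hbb : b ≤ b') (hcc : c ≤ c') : bendFun δ a b c ≤ bendFun δ a' b' c' := by
  unfold bendFun
  gcongr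

theorem bendGauge_pos (hδ : 0 ≤ δ) (ha : 0 < a) : 0 < bendGauge δ a b c :=
  ha.trans_le (le_bendGauge hδ)

/-- A gauge is subadditive when its unit sublevel set is convex: both triples are normalised and
combined with weights `s/(s+t)` and `t/(s+t)`. Since `c ≤ a` and `a` is at most the gauge, the
normalised `c` is at most `1`, where `bendFun` is convex. -/
theorem bendGauge_add_le (hδ : 0 ≤ δ) (ha : 0 ≤ a) (hb : 0 ≤ b) (hc : 0 ≤ c) (hba : b ≤ a)
    (hca : c ≤ a) (ha' : 0 ≤ a') (hb' : 0 ≤ b') (hc' : 0 ≤ c') (hba' : b' ≤ a')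
    (hca' : c' ≤ a') :
    bendGauge δ (a + a') (b + b') (c + c') ≤ bendGauge δ a b c + bendGauge δ a' b' c' := by
  rcases ha.eq_or_lt with rfl | ha
  · obtain rfl : b = 0 := le_antisymm hba hb
    obtain rfl : c = 0 := le_antisymm hca hc
    simp [bendGauge_nonneg]
  rcases ha'.eq_or_lt with rfl | ha'
  · obtain rfl : b' = 0 := le_antisymm hba' hb'
    obtain rfl : c' = 0 := le_antisymm hca' hc'
    simp [bendGauge_nonneg]
  set s := bendGauge δ a b c with hs
  set t := bendGauge δ a' b' c' with ht
  have hs0 : 0 < s := bendGauge_pos hδ ha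
  have ht0 : 0 < t := bendGauge_pos hδ ha'
  have hst : 0 < s + t := add_pos hs0 ht0
  have h1 : bendFun δ (s⁻¹ * a) (s⁻¹ * b) (s⁻¹ * c) ≤ 1 := by
    rw [← bendGauge_le_one_iff hδ, bendGauge_smul (inv_nonneg.2 hs0.le), ← hs,
      inv_mul_cancel₀ hs0.ne']
  have h2 : bendFun δ (t⁻¹ * a') (t⁻¹ * b') (t⁻¹ * c') ≤ 1 := by
    rw [← bendGauge_le_one_iff hδ, bendGauge_smul (inv_nonneg.2 ht0.le), ← ht,
      inv_mul_cancel₀ ht0.ne']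
  have hcs : s⁻¹ * c ≤ 1 := by
    rw [inv_mul_le_one₀ hs0]; exact hca.trans (le_bendGauge hδ)
  have hct : t⁻¹ * c' ≤ 1 := by
    rw [inv_mul_le_one₀ ht0]; exact hca'.trans (le_bendGauge hδ)
  have h3 := bendFun_combo_le (a := s⁻¹ * a) (b := s⁻¹ * b) (c := s⁻¹ * c) (a' := t⁻¹ * a')
    (b' := t⁻¹ * b') (c' := t⁻¹ * c') (l := s / (s + t)) (m := t / (s + t)) hδ (by positivity)
    (by positivity) (by field_simp) (by positivity) hcs (by positivity) hct
  have e : ∀ x y : ℝ, s / (s + t) * (s⁻¹ * x) + t / (s + t) * (t⁻¹ * y) =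
      (s + t)⁻¹ * (x + y) := by
    intro x y; field_simp
  rw [e, e, e] at h3
  have h4 : 0 ≤ δ * (s / (s + t) * (t / (s + t))) * (5 / 8 * (s⁻¹ * b - t⁻¹ * b') ^ 2 +
      (s⁻¹ * b * (s⁻¹ * c) - t⁻¹ * b' * (t⁻¹ * c') +
        (s + t)⁻¹ * (c + c') * (s⁻¹ * b - t⁻¹ * b')) ^ 2 / 8) := by positivity
  have h5 : s / (s + t) * bendFun δ (s⁻¹ * a) (s⁻¹ * b) (s⁻¹ * c) +
      t / (s + t) * bendFun δ (t⁻¹ * a') (t⁻¹ * b') (t⁻¹ * c') ≤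
      s / (s + t) * 1 + t / (s + t) * 1 := by gcongr
  have h6 : s / (s + t) * 1 + t / (s + t) * 1 = 1 := by field_simp
  have h7 : bendFun δ ((s + t)⁻¹ * (a + a')) ((s + t)⁻¹ * (b + b')) ((s + t)⁻¹ * (c + c')) ≤ 1 := by
    linarith
  rwa [← bendGauge_le_one_iff hδ, bendGauge_smul (inv_nonneg.2 hst.le), inv_mul_le_one₀ hst] at h7

theorem bendGauge_eq_one_iff (hδ : 0 ≤ δ) : bendGauge δ a b c = 1 ↔ bendFun δ a b c = 1 := by
  have hA : 0 ≤ a ^ 2 + δ * b ^ 2 := by positivity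
  have hB : 0 ≤ δ * b ^ 2 * c ^ 2 / 8 := by positivity
  have hF : bendFun δ a b c = (a ^ 2 + δ * b ^ 2) + δ * b ^ 2 * c ^ 2 / 8 := by
    rw [bendFun]; ring
  refine ⟨fun h => ?_, fun h => ?_⟩
  · rw [bendGauge, Real.sqrt_eq_one] at h
    rw [hF]
    generalize a ^ 2 + δ * b ^ 2 = A at *
    generalize δ * b ^ 2 * c ^ 2 / 8 = B at *
    have h2 := Real.sq_sqrt (show 0 ≤ A ^ 2 + 4 * B by positivity)
    have h3 : √(A ^ 2 + 4 * B) = 2 - A := by linarith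
    rw [h3] at h2
    linarith
  · rw [bendGauge, Real.sqrt_eq_one]
    rw [hF] at h
    generalize a ^ 2 + δ * b ^ 2 = A at *
    generalize δ * b ^ 2 * c ^ 2 / 8 = B at *
    have h3 : A ^ 2 + 4 * B = (2 - A) ^ 2 := by linarith
    rw [h3, Real.sqrt_sq (by linarith)]
    ring

/-- The equality case of `bendGauge_add_le` on the unit sphere, for a triple `(u, v, w)` dominated
by the sum. -/
theorem bendGauge_rigid {u v w : ℝ} (hδ : 0 < δ) (ha : 0 ≤ a) (hb : 0 ≤ b) (hc : 0 ≤ c)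
    (hca : c ≤ a) (ha' : 0 ≤ a') (hb' : 0 ≤ b') (hc' : 0 ≤ c') (hca' : c' ≤ a')
    (hu : 0 ≤ u) (hv : 0 ≤ v) (hw : 0 ≤ w) (hua : u ≤ a + a') (hvb : v ≤ b + b')
    (hwc : w ≤ c + c') (h1 : bendGauge δ a b c = 1) (h1' : bendGauge δ a' b' c' = 1)
    (h2 : bendGauge δ u v w = 2) : (b = 0 ∧ b' = 0) ∨ (c = c' ∧ w = c + c') := by
  have hc1 : c ≤ 1 := hca.trans (h1 ▸ le_bendGauge hδ.le)
  have hc1' : c' ≤ 1 := hca'.trans (h1' ▸ le_bendGauge hδ.le)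
  have hcombo := bendFun_combo_le (a := a) (b := b) (c := c) (a' := a') (b' := b') (c' := c')
    (l := 1 / 2) (m := 1 / 2) hδ.le (by norm_num) (by norm_num) (by norm_num) hc hc1 hc' hc1'
  rw [(bendGauge_eq_one_iff hδ.le).1 h1, (bendGauge_eq_one_iff hδ.le).1 h1'] at hcombo
  have hF : bendFun δ (1 / 2 * u) (1 / 2 * v) (1 / 2 * w) = 1 := by
    rw [← bendGauge_eq_one_iff hδ.le, bendGauge_smul (by norm_num), h2]; norm_num
  have hle : bendFun δ (1 / 2 * u) (1 / 2 * v) (1 / 2 * w) ≤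
      bendFun δ (1 / 2 * a + 1 / 2 * a') (1 / 2 * b + 1 / 2 * b') (1 / 2 * w) :=
    bendFun_mono hδ.le (by positivity) (by positivity) (by positivity) (by linarith)
      (by linarith) le_rfl
  have hle2 : bendFun δ (1 / 2 * a + 1 / 2 * a') (1 / 2 * b + 1 / 2 * b') (1 / 2 * w) ≤
      bendFun δ (1 / 2 * a + 1 / 2 * a') (1 / 2 * b + 1 / 2 * b') (1 / 2 * c + 1 / 2 * c') :=
    bendFun_mono hδ.le (by positivity) (by positivity) (by positivity) le_rfl le_rfl
      (by linarith)
  -- The midpoint already has value `1`, the average of the two endpoint values, so no defect of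
  -- convexity is left.
  have hd : δ * (1 / 2 * (1 / 2)) * (5 / 8 * (b - b') ^ 2 +
      (b * c - b' * c' + (1 / 2 * c + 1 / 2 * c') * (b - b')) ^ 2 / 8) ≤ 0 := by linarith
  have hd' : 5 / 8 * (b - b') ^ 2 +
      (b * c - b' * c' + (1 / 2 * c + 1 / 2 * c') * (b - b')) ^ 2 / 8 ≤ 0 :=
    nonpos_of_mul_nonpos_right hd (by positivity)
  have hbb : b = b' := by
    have : (b - b') ^ 2 ≤ 0 := by
      have := sq_nonneg (b * c - b' * c' + (1 / 2 * c + 1 / 2 * c') * (b - b'))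
      linarith
    exact sub_eq_zero.1 (pow_eq_zero_iff two_ne_zero |>.1 (le_antisymm this (sq_nonneg _)))
  subst hbb
  rcases hb.eq_or_lt with hb0 | hb0
  · exact Or.inl ⟨hb0.symm, hb0.symm⟩
  refine Or.inr ⟨?_, ?_⟩
  · have : (b * (c - c')) ^ 2 ≤ 0 := by linarith
    have h0 : b * (c - c') = 0 := pow_eq_zero_iff (two_ne_zero) |>.1 (le_antisymm this (sq_nonneg _))
    rcases mul_eq_zero.1 h0 with h | h
    · exact absurd h hb0.ne'
    · linarith
  · have h3 : bendFun δ (1 / 2 * a + 1 / 2 * a') (1 / 2 * b + 1 / 2 * b)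
        (1 / 2 * c + 1 / 2 * c') ≤ 1 := by
      have : 0 ≤ δ * (1 / 2 * (1 / 2)) * (5 / 8 * (b - b) ^ 2 +
        (b * c - b * c' + (1 / 2 * c + 1 / 2 * c') * (b - b)) ^ 2 / 8) := by positivity
      linarith
    -- Enlarging `w` to `c + c'` cannot raise the value above `1`; as `b > 0`, this leaves no room
    -- for `w < c + c'`.
    have h4 : δ * b ^ 2 * ((c + c') ^ 2 - w ^ 2) ≤ 0 := by
      have := h3.trans (hF.ge.trans hle)
      unfold bendFun at this
      linarith
    have h5 : (c + c') ^ 2 - w ^ 2 ≤ 0 := nonpos_of_mul_nonpos_right h4 (by positivity)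
    exact le_antisymm hwc ((sq_le_sq₀ (by positivity) hw).1 (by linarith))

end bend

/-! ### Extension of strictly convex norms -/

/-- The norm `bendGauge δ ‖x‖ d(x, K) ‖T x‖` on `E`. -/
def bendNorm {𝕜 : Type*} [RCLike 𝕜] {E H : Type*} [NormedAddCommGroup E] [NormedSpace 𝕜 E]
    [SeminormedAddCommGroup H] [NormedSpace 𝕜 H] (K : Submodule 𝕜 E) (T : E →ₗ[𝕜] H)
    (hT : ∀ x, ‖T x‖ ≤ ‖x‖) (δ : ℝ) (hδ : 0 ≤ δ) : LinearNorm 𝕜 E where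
  toFun x := bendGauge δ ‖x‖ ‖K.mkQ x‖ ‖T x‖
  map_zero' := by simp [bendGauge_zero_mid]
  add_le' x y := by
    refine (bendGauge_mono hδ (norm_nonneg _) (norm_nonneg _) (norm_nonneg _) (norm_add_le x y)
      (b' := ‖K.mkQ x‖ + ‖K.mkQ y‖) (c' := ‖T x‖ + ‖T y‖) ?_ ?_).trans ?_
    · rw [map_add]; exact norm_add_le _ _
    · rw [map_add]; exact norm_add_le _ _
    · exact bendGauge_add_le hδ (norm_nonneg _) (norm_nonneg _) (norm_nonneg _)
        (Submodule.Quotient.norm_mk_le K x) (hT x) (norm_nonneg _) (norm_nonneg _) (norm_nonneg _)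
        (Submodule.Quotient.norm_mk_le K y) (hT y)
  neg' x := by simp only [map_neg, norm_neg]
  smul' c x := by
    simp only [map_smul, norm_smul]
    exact bendGauge_smul (norm_nonneg c)
  eq_zero_of_map_eq_zero x hx := by
    have h : ‖x‖ ≤ 0 := (le_bendGauge hδ).trans hx.le
    exact norm_le_zero_iff.1 h

/-- A strictly convex norm on a closed subspace `K` of `E` extends to a strictly convex norm on
`E` that is as close to the given norm as desired, if `E` maps injectively into a strictly convex
space. -/
theorem exists_strictlyConvex_extension {𝕜 : Type*} [RCLike 𝕜] {E H : Type*}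
    [NormedAddCommGroup E] [NormedSpace 𝕜 E] [NormedAddCommGroup H] [NormedSpace 𝕜 H]
    (hH : IsStrictlyConvex 𝕜 H) (T : E →ₗ[𝕜] H) (hT : ∀ x, ‖T x‖ ≤ ‖x‖)
    (hinj : Function.Injective T) (K : Submodule 𝕜 E) (hK : IsClosed (K : Set E))
    (hKs : IsStrictlyConvex 𝕜 K) {δ : ℝ} (hδ : 0 < δ) :
    ∃ q : LinearNorm 𝕜 E, (∀ x ∈ K, q.toSeminorm x = ‖x‖) ∧
      (∀ x, ‖x‖ ≤ q.toSeminorm x ∧ q.toSeminorm x ≤ (1 + δ) * ‖x‖) ∧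
      IsStrictlyConvex 𝕜 (WithNorm q) := by
  let q := bendNorm K T hT δ hδ.le
  have hq : ∀ x, q.toSeminorm x = bendGauge δ ‖x‖ ‖K.mkQ x‖ ‖T x‖ := fun _ => rfl
  have hqK : ∀ x ∈ K, q.toSeminorm x = ‖x‖ := by
    intro x hx
    have : K.mkQ x = 0 := by simpa using hx
    rw [hq, this, norm_zero, bendGauge_zero_mid, abs_norm]
  refine ⟨q, hqK, fun x => ⟨le_bendGauge hδ.le, bendGauge_le hδ.le
    (norm_nonneg _) (norm_nonneg _) (Submodule.Quotient.norm_mk_le K x) (hT x)⟩, ?_⟩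
  refine isStrictlyConvex_of_norm_add_ne_two fun (x : E) (y : E) h1 h1' h2 => ?_
  have h1 : q.toSeminorm x = 1 := h1
  have h1' : q.toSeminorm y = 1 := h1'
  have h2 : q.toSeminorm (x + y) = 2 := h2
  have hmem : ∀ z, ‖K.mkQ z‖ = 0 → z ∈ K := fun z hz => by
    have := (QuotientAddGroup.norm_mk_eq_zero_iff_mem_closure (S := K.toAddSubgroup)).1 hz
    have h : z ∈ closure (K : Set E) := this
    rwa [hK.closure_eq] at h
  -- Either both points lie in `K`, where the old norm is strictly convex, or `T x` and `T y` have
  -- equal norms and equality in the triangle inequality.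
  rcases bendGauge_rigid hδ (norm_nonneg _) (norm_nonneg _) (norm_nonneg _) (hT x)
    (norm_nonneg _) (norm_nonneg _) (norm_nonneg _) (hT y) (norm_nonneg _) (norm_nonneg _)
    (norm_nonneg _) (norm_add_le x y) (by rw [map_add]; exact norm_add_le _ _)
    (by rw [map_add]; exact norm_add_le _ _) h1 h1' h2 with ⟨hb, hb'⟩ | ⟨hc, hw⟩
  · have hx := hmem x hb
    have hy := hmem y hb'
    rw [hqK x hx] at h1
    rw [hqK y hy] at h1'
    rw [hqK _ (K.add_mem hx hy)] at h2
    have := hKs.eq_of_norm_add (x := (⟨x, hx⟩ : K)) (y := ⟨y, hy⟩) (h1.trans h1'.symm) (by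
      change ‖x + y‖ = ‖x‖ + ‖y‖
      rw [h1, h1', h2]; norm_num)
    exact congrArg Subtype.val this
  · exact hinj (hH.eq_of_norm_add hc (by rw [← map_add]; exact hw))

/-! ### Unions of chains of normed spaces -/

section chain

variable {𝕜 : Type*} [RCLike 𝕜] {Y : ℕ → Type u} [∀ n, NormedAddCommGroup (Y n)]
  [∀ n, NormedSpace 𝕜 (Y n)] (J : ∀ n, Y n →ₗᵢ[𝕜] Y (n + 1))

/-- The sequences that are eventually coherent for the embeddings `J n`. -/
def coherentSubmodule : Submodule 𝕜 (∀ n, Y n) where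
  carrier := {s | ∀ᶠ n in atTop, s (n + 1) = J n (s n)}
  zero_mem' := Eventually.of_forall fun n => by simp
  add_mem' {s t} hs ht := by
    filter_upwards [hs, ht] with n h1 h2
    simp [h1, h2]
  smul_mem' c s hs := by
    filter_upwards [hs] with n h1
    simp [h1]

/-- The linear space of coherent sequences. It does not carry the topology of the product. -/
def CoherentSeq : Type u := coherentSubmodule J

instance : AddCommGroup (CoherentSeq J) := inferInstanceAs (AddCommGroup (coherentSubmodule J))

instance : Module 𝕜 (CoherentSeq J) := inferInstanceAs (Module 𝕜 (coherentSubmodule J))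

variable {J} in
/-- The entries of a coherent sequence. -/
def CoherentSeq.entry (s : CoherentSeq J) (n : ℕ) : Y n := s.1 n

variable {J} in
theorem CoherentSeq.eventually_succ (s : CoherentSeq J) :
    ∀ᶠ n in atTop, s.entry (n + 1) = J n (s.entry n) := s.2

/-- The eventual value of the norms of a coherent sequence. -/
def eventualNorm (s : CoherentSeq J) : ℝ := limUnder atTop fun n => ‖s.entry n‖

variable {J} in
theorem eventually_eventualNorm (s : CoherentSeq J) :
    ∀ᶠ n in atTop, ‖s.entry n‖ = eventualNorm J s := by
  obtain ⟨N, hN⟩ := eventually_atTop.1 s.eventually_succ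
  have h : ∀ n ≥ N, ‖s.entry n‖ = ‖s.entry N‖ := by
    intro n hn
    induction n, hn using Nat.le_induction with
    | base => rfl
    | succ n hn ih => rw [hN n hn, (J n).norm_map, ih]
  have h2 : Tendsto (fun n => ‖s.entry n‖) atTop (𝓝 ‖s.entry N‖) :=
    tendsto_nhds_of_eventually_eq (eventually_atTop.2 ⟨N, h⟩)
  filter_upwards [eventually_ge_atTop N] with n hn
  rw [eventualNorm, h2.limUnder_eq, h n hn]

instance : Norm (CoherentSeq J) := ⟨eventualNorm J⟩

variable {J} in
theorem eventually_norm_eq (s : CoherentSeq J) :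
    ∀ᶠ n in atTop, ‖s.entry n‖ = ‖s‖ := eventually_eventualNorm s

/-- Each axiom involves finitely many sequences, so it is read off at one late index at which all
the norms have stabilised. -/
theorem CoherentSeq.core : SeminormedSpace.Core 𝕜 (CoherentSeq J) where
  norm_nonneg s := by
    obtain ⟨n, hn⟩ := (eventually_norm_eq s).exists
    exact hn ▸ norm_nonneg _
  norm_smul c s := by
    obtain ⟨n, h1, h2⟩ := ((eventually_norm_eq s).and (eventually_norm_eq (c • s))).exists
    rw [← h1, ← h2]
    exact norm_smul c _
  norm_triangle s t := by
    obtain ⟨n, h1, h2, h3⟩ := ((eventually_norm_eq s).and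
      ((eventually_norm_eq t).and (eventually_norm_eq (s + t)))).exists
    rw [← h1, ← h2, ← h3]
    exact norm_add_le _ _

instance : SeminormedAddCommGroup (CoherentSeq J) :=
  SeminormedAddCommGroup.ofCore (CoherentSeq.core J)

instance : NormedSpace 𝕜 (CoherentSeq J) :=
  ⟨fun c s => ((CoherentSeq.core J).norm_smul c s).le⟩

/-- The sequence that vanishes before `n` and continues `x ∈ Y n` coherently. -/
def continuation (n : ℕ) (x : Y n) (k : ℕ) : Y k :=
  if h : n ≤ k then Nat.leRecOn h (fun {m} => J m) x else 0

theorem continuation_self (n : ℕ) (x : Y n) : continuation J n x n = x := by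
  simp [continuation, Nat.leRecOn_self]

theorem continuation_succ (n : ℕ) (x : Y n) {k : ℕ} (h : n ≤ k) :
    continuation J n x (k + 1) = J k (continuation J n x k) := by
  simp [continuation, h, h.trans (Nat.le_succ k), Nat.leRecOn_succ h]

theorem continuation_of_lt (n : ℕ) (x : Y n) {k : ℕ} (h : k < n) :
    continuation J n x k = 0 := by
  simp [continuation, not_le_of_gt h]

theorem continuation_ext {n : ℕ} {x : Y n} {s : ∀ n, Y n} (h0 : ∀ k < n, s k = 0) (hn : s n = x)
    (hs : ∀ k ≥ n, s (k + 1) = J k (s k)) : s = continuation J n x := by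
  funext k
  rcases lt_or_ge k n with h | h
  · rw [h0 k h, continuation_of_lt J n x h]
  · induction k, h using Nat.le_induction with
    | base => rw [hn, continuation_self]
    | succ k hk ih => rw [hs k hk, ih, continuation_succ J n x hk]

theorem continuation_add (n : ℕ) (x y : Y n) :
    continuation J n (x + y) = continuation J n x + continuation J n y :=
  Eq.symm <| continuation_ext J (fun k hk => by simp [continuation_of_lt J n _ hk])
    (by simp [continuation_self]) (fun k hk => by simp [continuation_succ J n _ hk])

theorem continuation_smul (n : ℕ) (c : 𝕜) (x : Y n) :
    continuation J n (c • x) = c • continuation J n x :=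
  Eq.symm <| continuation_ext J (fun k hk => by simp [continuation_of_lt J n _ hk])
    (by simp [continuation_self]) (fun k hk => by simp [continuation_succ J n _ hk])

/-- The isometric embedding of `Y n` into the space of coherent sequences. -/
def toCoherentSeq (n : ℕ) : Y n →ₗᵢ[𝕜] CoherentSeq J where
  toFun x := ⟨continuation J n x,
    eventually_atTop.2 ⟨n, fun _ hk => continuation_succ J n x hk⟩⟩
  map_add' x y := Subtype.ext (continuation_add J n x y)
  map_smul' c x := Subtype.ext (continuation_smul J n c x)
  norm_map' x := by
    set s : CoherentSeq J := ⟨continuation J n x,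
      eventually_atTop.2 ⟨n, fun _ hk => continuation_succ J n x hk⟩⟩ with hs
    obtain ⟨k, hk, hnk⟩ := ((eventually_norm_eq s).and (eventually_ge_atTop n)).exists
    change ‖s‖ = ‖x‖
    rw [← hk]
    change ‖continuation J n x k‖ = ‖x‖
    clear hk
    induction k, hnk using Nat.le_induction with
    | base => rw [continuation_self]
    | succ k hk ih => rw [continuation_succ J n x hk, (J k).norm_map, ih]

theorem norm_eq_zero_of_eventually_eq {s : CoherentSeq J}
    (h : ∀ᶠ n in atTop, s.entry n = 0) : ‖s‖ = 0 := by
  obtain ⟨n, h1, h2⟩ := (h.and (eventually_norm_eq s)).exists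
  rw [← h2, h1, norm_zero]

/-- The union of a chain of normed spaces. -/
theorem exists_union_of_chain :
    ∃ (X : Type u) (_ : NormedAddCommGroup X) (_ : NormedSpace 𝕜 X) (i : ∀ n, Y n →ₗᵢ[𝕜] X),
      (∀ n x, i (n + 1) (J n x) = i n x) ∧ ∀ x, ∃ n y, i n y = x := by
  -- Passing to the separation quotient identifies the sequences that agree eventually.
  let mk : CoherentSeq J →ₗᵢ[𝕜] SeparationQuotient (CoherentSeq J) :=
    ⟨(SeparationQuotient.mkCLM 𝕜 (CoherentSeq J)).toLinearMap, SeparationQuotient.norm_mk⟩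
  have hmk : ∀ s t : CoherentSeq J, ‖s - t‖ = 0 → mk s = mk t := fun s t h => by
    rw [← sub_eq_zero, ← map_sub, ← norm_eq_zero, mk.norm_map, h]
  refine ⟨SeparationQuotient (CoherentSeq J), inferInstance, inferInstance,
    fun n => mk.comp (toCoherentSeq J n), fun n x => ?_, fun x => ?_⟩
  · refine hmk _ _ (norm_eq_zero_of_eventually_eq J (eventually_atTop.2 ⟨n + 1, fun k hk => ?_⟩))
    change continuation J (n + 1) (J n x) k - continuation J n x k = 0
    rw [sub_eq_zero]
    induction k, hk using Nat.le_induction with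
    | base => rw [continuation_self, continuation_succ J n x le_rfl, continuation_self]
    | succ k hk ih =>
      rw [continuation_succ J _ _ hk, continuation_succ J n x ((Nat.le_succ n).trans hk), ih]
  · obtain ⟨s, rfl⟩ := SeparationQuotient.surjective_mk x
    obtain ⟨N, hN⟩ := eventually_atTop.1 s.eventually_succ
    refine ⟨N, s.entry N, hmk _ _ (norm_eq_zero_of_eventually_eq J
      (eventually_atTop.2 ⟨N, fun k hk => ?_⟩))⟩
    change continuation J N (s.entry N) k - s.entry k = 0
    rw [sub_eq_zero]
    induction k, hk using Nat.le_induction with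
    | base => rw [continuation_self]
    | succ k hk ih => rw [continuation_succ J N _ hk, ih, hN k hk]

end chain

/-! ### Properties of unions of chains -/

section union

variable {𝕜 : Type*} [RCLike 𝕜] {Y : ℕ → Type u} [∀ n, NormedAddCommGroup (Y n)]
  [∀ n, NormedSpace 𝕜 (Y n)] {J : ∀ n, Y n →ₗᵢ[𝕜] Y (n + 1)}
  {X : Type u} [NormedAddCommGroup X] [NormedSpace 𝕜 X] {i : ∀ n, Y n →ₗᵢ[𝕜] X}

theorem range_mono_of_chain (hi : ∀ n x, i (n + 1) (J n x) = i n x) :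
    Monotone fun n => LinearMap.range (i n).toLinearMap :=
  monotone_nat_of_le_succ fun n => by
    rintro _ ⟨x, rfl⟩
    exact ⟨J n x, hi n x⟩

/-- The bound `N` allows the member of the chain to be chosen so late that its norm is as close to
the supremum norm as needed. -/
theorem exists_finset_subset_range (hi : ∀ n x, i (n + 1) (J n x) = i n x)
    (hsurj : ∀ x, ∃ n y, i n y = x) (F : Finset X) (N : ℕ) :
    ∃ n ≥ N, ∀ x ∈ F, x ∈ LinearMap.range (i n).toLinearMap := by
  classical
  induction F using Finset.induction_on with
  | empty => exact ⟨N, le_rfl, by simp⟩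
  | insert a F _ ih =>
    obtain ⟨n, hn, hF⟩ := ih
    obtain ⟨m, y, hy⟩ := hsurj a
    refine ⟨max n m, hn.trans (le_max_left n m), fun x hx => ?_⟩
    rcases Finset.mem_insert.1 hx with rfl | hx
    · exact range_mono_of_chain hi (le_max_right n m) ⟨y, hy⟩
    · exact range_mono_of_chain hi (le_max_left n m) (hF x hx)

theorem isStrictlyConvex_union (hi : ∀ n x, i (n + 1) (J n x) = i n x)
    (hsurj : ∀ x, ∃ n y, i n y = x) (hY : ∀ n, IsStrictlyConvex 𝕜 (Y n)) :
    IsStrictlyConvex 𝕜 X := by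
  classical
  refine isStrictlyConvex_of_norm_add_ne_two fun x y hx hy hxy => ?_
  obtain ⟨n, -, hn⟩ := exists_finset_subset_range hi hsurj {x, y} 0
  obtain ⟨a, rfl⟩ := hn x (by simp)
  obtain ⟨b, rfl⟩ := hn y (by simp)
  change i n a = i n b
  change ‖i n a‖ = 1 at hx
  change ‖i n b‖ = 1 at hy
  change ‖i n a + i n b‖ = 2 at hxy
  rw [← map_add] at hxy
  rw [(i n).norm_map] at hx hy hxy
  rw [(hY n).eq_of_norm_add (hx.trans hy.symm) (by rw [hx, hy, hxy]; norm_num)]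

theorem separableSpace_union (hsurj : ∀ x, ∃ n y, i n y = x)
    [∀ n, TopologicalSpace.SeparableSpace (Y n)] : TopologicalSpace.SeparableSpace X := by
  have h : TopologicalSpace.IsSeparable (⋃ n, Set.range (i n)) :=
    TopologicalSpace.IsSeparable.iUnion fun n =>
      TopologicalSpace.isSeparable_range (i n).continuous
  have hu : (⋃ n, Set.range (i n)) = Set.univ :=
    Set.eq_univ_of_forall fun x => Set.mem_iUnion.2 (hsurj x)
  rw [hu] at h
  exact TopologicalSpace.isSeparable_univ_iff.1 h

/-- The ranges are closed, being complete. If `X` were complete, Baire's theorem would give one of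
them an interior point; that range would be all of `X`, and the next embedding `J n` would be onto.
-/
theorem not_completeSpace_union (hi : ∀ n x, i (n + 1) (J n x) = i n x)
    (hsurj : ∀ x, ∃ n y, i n y = x) [∀ n, CompleteSpace (Y n)]
    (hJ : ∀ n, ¬ Function.Surjective (J n)) : ¬ CompleteSpace X := by
  intro hX
  obtain ⟨n, hn⟩ := nonempty_interior_of_iUnion_of_closed
    (f := fun n => Set.range (i n)) (fun n => (i n).isometry.isClosedEmbedding.isClosed_range)
    (Set.eq_univ_of_forall fun x => Set.mem_iUnion.2 (hsurj x))
  have htop : LinearMap.range (i n).toLinearMap = ⊤ :=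
    Submodule.eq_top_of_nonempty_interior' _ hn
  refine hJ n fun z => ?_
  obtain ⟨y, hy⟩ : i (n + 1) z ∈ LinearMap.range (i n).toLinearMap := htop ▸ Submodule.mem_top
  refine ⟨y, (i (n + 1)).injective ?_⟩
  rw [hi, ← hy]
  rfl

end union

open scoped ComplexOrder

/-! ### Absolutely convex hulls of slices -/

section slice

variable {𝕜 : Type*} [RCLike 𝕜] {X : Type*} [NormedAddCommGroup X] [NormedSpace 𝕜 X]

theorem exists_norm_eq_one_mul_eq_norm (a : 𝕜) : ∃ ω : 𝕜, ‖ω‖ = 1 ∧ ω * a = (‖a‖ : 𝕜) := by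
  rcases eq_or_ne a 0 with rfl | ha
  · exact ⟨1, by simp, by simp⟩
  · have h : (‖a‖ : 𝕜) ≠ 0 := by simpa using ha
    refine ⟨(‖a‖ : 𝕜) / a, ?_, by field_simp⟩
    rw [norm_div, RCLike.norm_ofReal, abs_norm, div_self (norm_ne_zero_iff.2 ha)]

theorem exists_norm_eq_one_eq_norm_mul (a : 𝕜) : ∃ ω : 𝕜, ‖ω‖ = 1 ∧ a = (‖a‖ : 𝕜) * ω := by
  rcases eq_or_ne a 0 with rfl | ha
  · exact ⟨1, by simp, by simp⟩
  · have h : (‖a‖ : 𝕜) ≠ 0 := by simpa using ha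
    refine ⟨a / (‖a‖ : 𝕜), ?_, by field_simp⟩
    rw [norm_div, RCLike.norm_ofReal, abs_norm, div_self (norm_ne_zero_iff.2 ha)]

/-- A unimodular rotation moves `z` into the slice, and the hull is balanced. -/
theorem mem_absConvexHull_slice {f : X →L[𝕜] 𝕜} {ε : ℝ} {z : X} (hz : ‖z‖ ≤ 1)
    (hf : 1 - ε < ‖f z‖) : z ∈ absConvexHull 𝕜 (slice f ε) := by
  obtain ⟨ω, hω, h⟩ := exists_norm_eq_one_mul_eq_norm (f z)
  have hω0 : ω ≠ 0 := norm_ne_zero_iff.1 (by rw [hω]; exact one_ne_zero)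
  have hmem : ω • z ∈ slice f ε := by
    refine ⟨by rw [norm_smul, hω, one_mul]; exact hz, ?_⟩
    rw [map_smul, smul_eq_mul, h, RCLike.ofReal_re]
    exact hf
  have := (balanced_absConvexHull (𝕜 := 𝕜) (s := slice f ε)).smul_mem (a := ω⁻¹)
    (by rw [norm_inv, hω, inv_one]) (subset_absConvexHull hmem)
  rwa [inv_smul_smul₀ hω0] at this

theorem absConvex_norm_le (φ : X →L[𝕜] 𝕜) (M : ℝ) : AbsConvex 𝕜 {z | ‖φ z‖ ≤ M} := by
  refine ⟨balanced_iff_smul_mem.2 fun {c} hc z hz => ?_, fun x hx y hy a b ha hb hab => ?_⟩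
  · rw [Set.mem_ofPred_eq, map_smul, norm_smul]
    exact (mul_le_of_le_one_left (norm_nonneg _) hc).trans hz
  · have hx : ‖φ x‖ ≤ M := hx
    have hy : ‖φ y‖ ≤ M := hy
    have ha' : (‖a‖ : 𝕜) = a := RCLike.norm_of_nonneg' ha
    have hb' : (‖b‖ : 𝕜) = b := RCLike.norm_of_nonneg' hb
    have h1 : ‖a‖ + ‖b‖ = 1 := by
      have : ((‖a‖ + ‖b‖ : ℝ) : 𝕜) = 1 := by
        rw [RCLike.ofReal_add, ha', hb', hab]
      exact_mod_cast this
    calc ‖φ (a • x + b • y)‖ ≤ ‖a‖ * ‖φ x‖ + ‖b‖ * ‖φ y‖ := by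
          rw [map_add, map_smul, map_smul, ← norm_smul, ← norm_smul]
          exact norm_add_le _ _
      _ ≤ ‖a‖ * M + ‖b‖ * M := by gcongr
      _ = M := by rw [← add_mul, h1, one_mul]

theorem exists_mem_slice_of_lt {f φ : X →L[𝕜] 𝕜} {ε M : ℝ} {w : X}
    (hw : w ∈ absConvexHull 𝕜 (slice f ε)) (hM : M < ‖φ w‖) : ∃ z ∈ slice f ε, M < ‖φ z‖ := by
  by_contra! h
  exact absurd (absConvexHull_min h (absConvex_norm_le φ M) hw) (not_le_of_gt hM)

end slice

/-! ### Spaces that are locally close to `C[0, 1]` are lush -/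

section lush

variable {𝕜 : Type*} [RCLike 𝕜] {X : Type*} [NormedAddCommGroup X] [NormedSpace 𝕜 X]

/-- A function in the unit ball is, up to `ε`, a convex combination of functions in the unit ball
that have modulus one at a prescribed point. -/
theorem exists_combo_peak (k : C(unitInterval, 𝕜)) (hk : ‖k‖ ≤ 1) (t₀ : unitInterval) {ε : ℝ}
    (hε : 0 < ε) : ∃ (z z' : C(unitInterval, 𝕜)) (r r' : ℝ), ‖z‖ ≤ 1 ∧ ‖z'‖ ≤ 1 ∧
      ‖z t₀‖ = 1 ∧ ‖z' t₀‖ = 1 ∧ 0 ≤ r ∧ 0 ≤ r' ∧ r + r' = 1 ∧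
      ‖k - ((r : 𝕜) • z + (r' : 𝕜) • z')‖ ≤ ε := by
  obtain ⟨ω, hω, hkω⟩ := exists_norm_eq_one_eq_norm_mul (k t₀)
  have hk1 : ∀ t, ‖k t‖ ≤ 1 := fun t => (k.norm_coe_le_norm t).trans hk
  -- A bump at `t₀`, supported where `k` differs from `k t₀` by at most `ε`. There `k` is blended
  -- into the constants `ω` and `-ω`; the weights `(1 ± ‖k t₀‖)/2` average these to `k t₀`, so the
  -- error is `b (k - k t₀)`.
  let b : unitInterval → ℝ := fun t => max 0 (1 - ‖k t - k t₀‖ / ε)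
  have hb : Continuous b := by fun_prop
  have hb0 : ∀ t, 0 ≤ b t := fun t => le_max_left _ _
  have hb1 : ∀ t, b t ≤ 1 := fun t =>
    max_le zero_le_one (sub_le_self _ (by positivity))
  have hbt : b t₀ = 1 := by simp [b]
  let z : 𝕜 → C(unitInterval, 𝕜) := fun c =>
    ⟨fun t => ((1 - b t : ℝ) : 𝕜) * k t + (b t : 𝕜) * c, by fun_prop⟩
  have hz : ∀ c, ‖c‖ = 1 → ‖z c‖ ≤ 1 := fun c hc => by
    refine (ContinuousMap.norm_le _ zero_le_one).2 fun t => ?_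
    calc ‖((1 - b t : ℝ) : 𝕜) * k t + (b t : 𝕜) * c‖
        ≤ ‖((1 - b t : ℝ) : 𝕜) * k t‖ + ‖(b t : 𝕜) * c‖ := norm_add_le _ _
      _ = (1 - b t) * ‖k t‖ + b t := by
          rw [norm_mul, norm_mul, hc, mul_one, RCLike.norm_of_nonneg (sub_nonneg.2 (hb1 t)),
            RCLike.norm_of_nonneg (hb0 t)]
      _ ≤ (1 - b t) * 1 + b t := by
          gcongr
          · exact sub_nonneg.2 (hb1 t)
          · exact hk1 t
      _ = 1 := by ring
  have hz0 : ∀ c, z c t₀ = c := fun c => by simp [z, hbt]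
  refine ⟨z ω, z (-ω), (1 + ‖k t₀‖) / 2, (1 - ‖k t₀‖) / 2, hz _ hω, hz _ (by rwa [norm_neg]),
    by rw [hz0, hω], by rw [hz0, norm_neg, hω], by positivity, by linarith [hk1 t₀], by ring, ?_⟩
  refine (ContinuousMap.norm_le _ hε.le).2 fun t => ?_
  have h1 : (k - ((((1 + ‖k t₀‖) / 2 : ℝ) : 𝕜) • z ω + (((1 - ‖k t₀‖) / 2 : ℝ) : 𝕜) • z (-ω))) t =
      (b t : 𝕜) * (k t - k t₀) := by
    rw [hkω]
    simp only [z, ContinuousMap.sub_apply, ContinuousMap.add_apply, ContinuousMap.smul_apply,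
      ContinuousMap.coe_mk, smul_eq_mul, norm_mul, RCLike.norm_ofReal, abs_norm, hω, mul_one]
    push_cast
    ring
  rw [h1, norm_mul, RCLike.norm_of_nonneg (hb0 t)]
  rcases le_or_gt ‖k t - k t₀‖ ε with h | h
  · exact (mul_le_of_le_one_left (norm_nonneg _) (hb1 t)).trans h
  · have : b t = 0 := max_eq_left (by
      have : 1 < ‖k t - k t₀‖ / ε := (one_lt_div hε).2 h
      linarith)
    rw [this, zero_mul]
    exact hε.le

/-- The evaluation at a point extends to a contractive functional. -/
theorem exists_extension_eval (i : C(unitInterval, 𝕜) →ₗ[𝕜] X) (hi : ∀ u, ‖u‖ ≤ ‖i u‖)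
    (t₀ : unitInterval) : ∃ f : X →L[𝕜] 𝕜, ‖f‖ ≤ 1 ∧ ∀ u, f (i u) = u t₀ := by
  have hinj : Function.Injective i := (injective_iff_map_eq_zero i).2 fun u hu => by
    have := hi u
    rw [hu, norm_zero] at this
    exact norm_le_zero_iff.1 this
  let e := LinearEquiv.ofInjective i hinj
  let φ : LinearMap.range i →ₗ[𝕜] 𝕜 := (ContinuousMap.evalCLM 𝕜 t₀).toLinearMap ∘ₗ e.symm.toLinearMap
  have hφ : ∀ w, ‖φ w‖ ≤ 1 * ‖w‖ := by
    intro w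
    obtain ⟨u, rfl⟩ := e.surjective w
    have h1 : φ (e u) = u t₀ := by simp [φ]
    rw [h1, one_mul]
    exact (u.norm_coe_le_norm t₀).trans (hi u)
  obtain ⟨f, hf, hfn⟩ := exists_extension_norm_eq _ (φ.mkContinuous 1 hφ)
  refine ⟨f, hfn.trans_le (φ.mkContinuous_norm_le zero_le_one hφ), fun u => ?_⟩
  have h1 := hf (e u)
  have h2 : φ (e u) = u t₀ := by simp [φ]
  exact h1.trans h2

/-- Evaluation at a peak `t₀` of `|g|`, extended by Hahn–Banach, rotated and normalised, puts `x = i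
g` in the slice. By `exists_combo_peak`, `k` is nearly a convex combination of functions unimodular
at `t₀`, whose images, shrunk by `(1 + δ)⁻¹`, lie in the hull. -/
theorem isLush_of_locally_unitInterval
    (h : ∀ δ : ℝ, 0 < δ → ∀ x y : X, ∃ i : C(unitInterval, 𝕜) →ₗ[𝕜] X,
      (∀ u, ‖u‖ ≤ ‖i u‖ ∧ ‖i u‖ ≤ (1 + δ) * ‖u‖) ∧ (∃ u, i u = x) ∧ ∃ u, i u = y) :
    IsLush 𝕜 X := by
  intro x y hx hy ε hε
  -- The final error is `2δ + δ²`, which is at most `3δ < ε`.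
  obtain ⟨δ, hδ, hδ1, hδε⟩ : ∃ δ : ℝ, 0 < δ ∧ δ ≤ 1 ∧ 4 * δ ≤ ε :=
    ⟨min 1 (ε / 4), by positivity, min_le_left _ _, by
      have := min_le_right 1 (ε / 4); linarith⟩
  obtain ⟨i, hi, ⟨g, rfl⟩, ⟨k, rfl⟩⟩ := h δ hδ x y
  have hk : ‖k‖ ≤ 1 := (hi k).1.trans hy.le
  have hg : (1 + δ)⁻¹ ≤ ‖g‖ := by
    have := (hi g).2
    rw [hx] at this
    rwa [inv_le_iff_one_le_mul₀' (by positivity)]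
  have hinv : 1 - ε < (1 + δ)⁻¹ := by
    have : 1 - δ ≤ (1 + δ)⁻¹ := by
      rw [← one_div, le_div_iff₀ (by positivity)]; nlinarith
    linarith
  obtain ⟨t₀, ht₀⟩ : ∃ t₀, ‖g t₀‖ = ‖g‖ := by
    obtain ⟨t₀, ht₀⟩ := (isCompact_univ (X := unitInterval)).exists_isMaxOn Set.univ_nonempty
      (g.continuous.norm.continuousOn)
    exact ⟨t₀, le_antisymm (g.norm_coe_le_norm t₀) ((ContinuousMap.norm_le _ (norm_nonneg _)).2
      fun t => ht₀.2 (Set.mem_univ t))⟩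
  obtain ⟨f, hf, hfi⟩ := exists_extension_eval i (fun u => (hi u).1) t₀
  obtain ⟨ω, hω, hωg⟩ := exists_norm_eq_one_mul_eq_norm (g t₀)
  have hgpos : 0 < ‖g‖ := lt_of_lt_of_le (by positivity) hg
  have hfpos : 0 < ‖f‖ := by
    have := f.le_opNorm (i g)
    rw [hfi, ht₀, hx, mul_one] at this
    exact hgpos.trans_le this
  let F : X →L[𝕜] 𝕜 := (((‖f‖⁻¹ : ℝ) : 𝕜) * ω) • f
  have hF : ∀ u, ‖u t₀‖ ≤ ‖F (i u)‖ := fun u => by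
    simp only [F, smul_apply, norm_smul, norm_mul, hω, hfi,
      RCLike.norm_of_nonneg (inv_nonneg.2 hfpos.le), mul_one]
    exact le_mul_of_one_le_left (norm_nonneg _) ((one_le_inv₀ hfpos).2 hf)
  have hF1 : ‖F‖ = 1 := by
    simp only [F, norm_smul, norm_mul, hω, RCLike.norm_of_nonneg (inv_nonneg.2 hfpos.le), mul_one]
    exact inv_mul_cancel₀ hfpos.ne'
  have hFg : F (i g) = ((‖f‖⁻¹ * ‖g‖ : ℝ) : 𝕜) := by
    simp only [F, smul_apply, hfi, smul_eq_mul, mul_assoc, hωg, ht₀]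
    push_cast
    rfl
  have hxs : i g ∈ slice F ε := by
    refine ⟨hx.le, ?_⟩
    rw [hFg, RCLike.ofReal_re]
    exact hinv.trans_le (hg.trans (le_mul_of_one_le_left (norm_nonneg _)
      ((one_le_inv₀ hfpos).2 hf)))
  refine ⟨F, hF1, hxs, ?_⟩
  obtain ⟨z, z', r, r', hz, hz', hzt, hzt', hr, hr', hrr, hkz⟩ := exists_combo_peak k hk t₀ hδ
  let ρ : 𝕜 := (((1 + δ)⁻¹ : ℝ) : 𝕜)
  have hρ : ‖ρ‖ = (1 + δ)⁻¹ := RCLike.norm_of_nonneg (by positivity)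
  have hmem : ∀ u : C(unitInterval, 𝕜), ‖u‖ ≤ 1 → ‖u t₀‖ = 1 →
      ρ • i u ∈ absConvexHull 𝕜 (slice F ε) := fun u hu hut => by
    refine mem_absConvexHull_slice ?_ ?_
    · rw [norm_smul, hρ, inv_mul_le_one₀ (by positivity)]
      exact (hi u).2.trans (mul_le_of_le_one_right (by positivity) hu)
    · rw [map_smul, norm_smul, hρ]
      refine hinv.trans_le (le_mul_of_one_le_right (by positivity) ?_)
      exact hut ▸ hF u
  have hw : (r : 𝕜) • (ρ • i z) + (r' : 𝕜) • (ρ • i z') ∈ absConvexHull 𝕜 (slice F ε) :=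
    convex_absConvexHull (hmem z hz hzt) (hmem z' hz' hzt') (by exact_mod_cast hr)
      (by exact_mod_cast hr') (by exact_mod_cast hrr)
  refine (Metric.infDist_lt_iff ⟨_, hw⟩).2 ⟨_, hw, ?_⟩
  set v := (r : 𝕜) • z + (r' : 𝕜) • z' with hv
  have hv1 : ‖v‖ ≤ 1 := by
    calc ‖v‖ ≤ ‖(r : 𝕜) • z‖ + ‖(r' : 𝕜) • z'‖ := norm_add_le _ _
      _ = r * ‖z‖ + r' * ‖z'‖ := by
        rw [norm_smul, norm_smul, RCLike.norm_of_nonneg hr, RCLike.norm_of_nonneg hr']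
      _ ≤ r * 1 + r' * 1 := by gcongr
      _ = 1 := by rw [mul_one, mul_one, hrr]
  have e1 : i k - ((r : 𝕜) • (ρ • i z) + (r' : 𝕜) • (ρ • i z')) =
      i (k - v) + (1 - ρ) • i v := by
    rw [hv]
    simp only [map_sub, map_add, map_smul]
    module
  have hρ1 : ‖(1 - ρ : 𝕜)‖ = 1 - (1 + δ)⁻¹ := by
    have : (1 - ρ : 𝕜) = ((1 - (1 + δ)⁻¹ : ℝ) : 𝕜) := by simp [ρ]
    rw [this, RCLike.norm_of_nonneg (sub_nonneg.2 (inv_le_one_of_one_le₀ (by linarith)))]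
  have h2 : 0 ≤ 1 - (1 + δ)⁻¹ := hρ1 ▸ norm_nonneg _
  rw [dist_eq_norm, e1]
  calc ‖i (k - v) + (1 - ρ) • i v‖ ≤ ‖i (k - v)‖ + ‖(1 - ρ) • i v‖ := norm_add_le _ _
    _ = ‖i (k - v)‖ + (1 - (1 + δ)⁻¹) * ‖i v‖ := by rw [norm_smul, hρ1]
    _ ≤ (1 + δ) * δ + (1 - (1 + δ)⁻¹) * ((1 + δ) * 1) := by
        gcongr
        · exact (hi _).2.trans (by gcongr)
        · exact (hi _).2.trans (by gcongr)
    _ = (1 + δ) * δ + δ := by field_simp; ring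
    _ < ε := by nlinarith

end lush

/-! ### Lushness and the numerical index -/

section index

variable {𝕜 : Type*} [RCLike 𝕜] {X : Type*} [NormedAddCommGroup X] [NormedSpace 𝕜 X]

theorem norm_le_opNorm_of_mem_numericalRange {T : X →L[𝕜] X} {c : 𝕜}
    (hc : c ∈ numericalRange T) : ‖c‖ ≤ ‖T‖ := by
  obtain ⟨x, f, hx, hf, -, rfl⟩ := hc
  calc ‖f (T x)‖ ≤ ‖f‖ * (‖T‖ * ‖x‖) := f.le_opNorm_of_le (T.le_opNorm x)
    _ = ‖T‖ := by rw [hf, hx, one_mul, mul_one]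

theorem bddAbove_norm_numericalRange (T : X →L[𝕜] X) :
    BddAbove ((fun c : 𝕜 => ‖c‖) '' numericalRange T) :=
  ⟨‖T‖, by rintro _ ⟨c, hc, rfl⟩; exact norm_le_opNorm_of_mem_numericalRange hc⟩

theorem numericalRadius_le_norm (T : X →L[𝕜] X) : numericalRadius T ≤ ‖T‖ :=
  Real.sSup_le (by rintro _ ⟨c, hc, rfl⟩; exact norm_le_opNorm_of_mem_numericalRange hc)
    (norm_nonneg T)

theorem numericalRadius_nonneg (T : X →L[𝕜] X) : 0 ≤ numericalRadius T :=
  Real.sSup_nonneg (by rintro _ ⟨c, -, rfl⟩; exact norm_nonneg c)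

/-- Lumer's lower estimate for the perturbations of the identity. -/
theorem one_sub_mul_norm_le (T : X →L[𝕜] X) {c : 𝕜} (x : X) :
    (1 - ‖c‖ * numericalRadius T) * ‖x‖ ≤ ‖x - c • T x‖ := by
  rcases eq_or_ne x 0 with rfl | hx
  · simp
  have hx0 : ‖x‖ ≠ 0 := norm_ne_zero_iff.2 hx
  obtain ⟨f, hf, hfx⟩ := exists_dual_vector 𝕜 x hx0
  have hmem : f (T (((‖x‖⁻¹ : ℝ) : 𝕜) • x)) ∈ numericalRange T := by
    refine ⟨_, f, ?_, hf, ?_, rfl⟩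
    · rw [norm_smul, RCLike.norm_of_nonneg (by positivity), inv_mul_cancel₀ hx0]
    · rw [map_smul, hfx, smul_eq_mul, ← RCLike.ofReal_mul, inv_mul_cancel₀ hx0, RCLike.ofReal_one]
  have h1 : ‖f (T x)‖ ≤ numericalRadius T * ‖x‖ := by
    have h2 := le_csSup (bddAbove_norm_numericalRange T) ⟨_, hmem, rfl⟩
    simp only [map_smul, norm_smul, RCLike.norm_of_nonneg (inv_nonneg.2 (norm_nonneg x))] at h2
    rwa [inv_mul_le_iff₀ (by positivity), mul_comm] at h2
  have h3 : ‖f (x - c • T x)‖ ≤ ‖x - c • T x‖ := by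
    simpa [hf] using f.le_opNorm (x - c • T x)
  have h4 : ‖x‖ ≤ ‖f (x - c • T x)‖ + ‖c‖ * ‖f (T x)‖ := by
    have h5 : (‖x‖ : 𝕜) = f (x - c • T x) + c * f (T x) := by
      rw [map_sub, map_smul, smul_eq_mul, hfx]; ring
    calc ‖x‖ = ‖(‖x‖ : 𝕜)‖ := by rw [RCLike.norm_ofReal, abs_norm]
      _ ≤ _ := by rw [h5, ← norm_mul]; exact norm_add_le _ _
  have h5 : ‖c‖ * ‖f (T x)‖ ≤ ‖c‖ * (numericalRadius T * ‖x‖) := by gcongr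
  linarith

/-- Lumer's estimate is applied to `u + c T u`: the product `(1 - cT)(1 + cT) = 1 - c²T²` has only a
second-order term. -/
theorem numericalRadius_mul_norm_add_le {T : X →L[𝕜] X} (hT : ‖T‖ = 1) {c : 𝕜} (u : X) :
    (1 - ‖c‖ * numericalRadius T) * ‖u + c • T u‖ ≤ (1 + ‖c‖ ^ 2) * ‖u‖ := by
  have hTu : ‖T (T u)‖ ≤ ‖u‖ := by
    have h1 := T.le_opNorm (T u)
    have h2 := T.le_opNorm u
    rw [hT, one_mul] at h1 h2
    exact h1.trans h2
  calc (1 - ‖c‖ * numericalRadius T) * ‖u + c • T u‖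
      ≤ ‖(u + c • T u) - c • T (u + c • T u)‖ := one_sub_mul_norm_le T _
    _ = ‖u - (c ^ 2) • T (T u)‖ := by
        congr 1
        rw [map_add, map_smul]
        module
    _ ≤ ‖u‖ + ‖(c ^ 2) • T (T u)‖ := norm_sub_le _ _
    _ ≤ ‖u‖ + ‖c‖ ^ 2 * ‖u‖ := by rw [norm_smul, norm_pow]; gcongr
    _ = _ := by ring

theorem IsLush.exists_almost_extreme (h : IsLush 𝕜 X) {T : X →L[𝕜] X} (hT : ‖T‖ = 1) {ε : ℝ}
    (hε : 0 < ε) (hε1 : ε < 1) : ∃ (f : X →L[𝕜] 𝕜) (z : X), ‖f‖ = 1 ∧ z ∈ slice f ε ∧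
      (1 - ε) ^ 2 - ε < ‖f (T z)‖ := by
  obtain ⟨x, hx, hTx⟩ : ∃ x, ‖x‖ = 1 ∧ 1 - ε < ‖T x‖ := by
    obtain ⟨x, hx, hTx⟩ := T.exists_lt_apply_of_lt_opNorm (r := 1 - ε) (by rw [hT]; linarith)
    have hx0 : x ≠ 0 := by
      rintro rfl
      rw [map_zero, norm_zero] at hTx
      linarith
    have hx1 : 0 < ‖x‖ := norm_pos_iff.2 hx0
    refine ⟨((‖x‖⁻¹ : ℝ) : 𝕜) • x, ?_, ?_⟩
    · rw [norm_smul, RCLike.norm_of_nonneg (by positivity), inv_mul_cancel₀ hx1.ne']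
    · rw [map_smul, norm_smul, RCLike.norm_of_nonneg (by positivity)]
      exact hTx.trans_le (le_mul_of_one_le_left (norm_nonneg _) ((one_le_inv₀ hx1).2 hx.le))
  have hTx0 : 0 < ‖T x‖ := lt_trans (by linarith) hTx
  -- The normalised `T x` is placed in the slice and `x` near its hull. Then `|f ∘ T|` is almost `1`
  -- at `x`, hence almost as large at some point of the slice.
  obtain ⟨f, hf, hyf, hd⟩ := h (((‖T x‖⁻¹ : ℝ) : 𝕜) • T x) x
    (by rw [norm_smul, RCLike.norm_of_nonneg (by positivity), inv_mul_cancel₀ hTx0.ne']) hx ε hε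
  obtain ⟨w, hw, hxw⟩ := (Metric.infDist_lt_iff ⟨_, subset_absConvexHull hyf⟩).1 hd
  have h1 : (1 - ε) ^ 2 ≤ ‖f (T x)‖ := by
    have h2 : 1 - ε ≤ ‖T x‖⁻¹ * ‖f (T x)‖ := by
      have := hyf.2.le.trans (RCLike.re_le_norm _)
      rwa [map_smul, norm_smul, RCLike.norm_of_nonneg (by positivity)] at this
    rw [le_inv_mul_iff₀ hTx0] at h2
    nlinarith
  have h3 : ‖f (T x)‖ - ‖f (T w)‖ ≤ ‖x - w‖ := by
    calc ‖f (T x)‖ - ‖f (T w)‖ ≤ ‖f (T x) - f (T w)‖ := norm_sub_norm_le _ _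
      _ = ‖f (T (x - w))‖ := by rw [map_sub, map_sub]
      _ ≤ ‖f‖ * (‖T‖ * ‖x - w‖) := f.le_opNorm_of_le (T.le_opNorm _)
      _ = ‖x - w‖ := by rw [hf, hT, one_mul, one_mul]
  rw [dist_eq_norm] at hxw
  obtain ⟨z, hz, hz'⟩ := exists_mem_slice_of_lt (φ := f.comp T) (M := (1 - ε) ^ 2 - ε) hw (by
    change _ < ‖f (T w)‖
    linarith)
  exact ⟨f, z, hf, hz, hz'⟩

/-- An almost extreme pair shows that `1 + t ω T` has norm close to `1 + t` for some unimodular `ω`.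
The second-order bound then yields `(1 - t v)(1 + t) ≤ 1 + t²`, which for small `t` forces `v ≥ 1`.
-/
theorem IsLush.one_le_numericalRadius (h : IsLush 𝕜 X) {T : X →L[𝕜] X} (hT : ‖T‖ = 1) :
    1 ≤ numericalRadius T := by
  set v := numericalRadius T with hv
  have hv0 : 0 ≤ v := numericalRadius_nonneg T
  have hv1 : v ≤ 1 := hT ▸ numericalRadius_le_norm T
  have key : ∀ t : ℝ, 0 < t → t < 1 → (1 - t * v) * (1 + t) ≤ 1 + t ^ 2 := by
    intro t ht ht1
    have htv : 0 ≤ 1 - t * v := by nlinarith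
    have main : ∀ ε : ℝ, 0 < ε → ε < 1 →
        (1 - t * v) * ((1 - ε) + t * ((1 - ε) ^ 2 - ε)) ≤ 1 + t ^ 2 := by
      intro ε hε hε1
      obtain ⟨f, z, hf, hz, hfz⟩ := h.exists_almost_extreme hT hε hε1
      obtain ⟨ω, hω, hωf⟩ := exists_norm_eq_one_mul_eq_norm (f (T z))
      have hc : ‖(t : 𝕜) * ω‖ = t := by rw [norm_mul, hω, RCLike.norm_of_nonneg ht.le, mul_one]
      have h1 := numericalRadius_mul_norm_add_le hT (c := (t : 𝕜) * ω) z
      rw [hc, ← hv] at h1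
      have h2 : (1 - ε) + t * ((1 - ε) ^ 2 - ε) ≤ ‖z + ((t : 𝕜) * ω) • T z‖ := by
        have h3 : f (z + ((t : 𝕜) * ω) • T z) = f z + ((t * ‖f (T z)‖ : ℝ) : 𝕜) := by
          rw [map_add, map_smul, smul_eq_mul, mul_assoc, hωf, RCLike.ofReal_mul]
        calc (1 - ε) + t * ((1 - ε) ^ 2 - ε) ≤ RCLike.re (f z) + t * ‖f (T z)‖ := by
              gcongr
              exact hz.2.le
          _ = RCLike.re (f (z + ((t : 𝕜) * ω) • T z)) := by
              rw [h3, map_add, RCLike.ofReal_re]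
          _ ≤ ‖f (z + ((t : 𝕜) * ω) • T z)‖ := RCLike.re_le_norm _
          _ ≤ ‖z + ((t : 𝕜) * ω) • T z‖ := by
              simpa only [hf, one_mul] using f.le_opNorm (z + ((t : 𝕜) * ω) • T z)
      calc (1 - t * v) * ((1 - ε) + t * ((1 - ε) ^ 2 - ε))
          ≤ (1 - t * v) * ‖z + ((t : 𝕜) * ω) • T z‖ := by gcongr
        _ ≤ (1 + t ^ 2) * ‖z‖ := h1
        _ ≤ 1 + t ^ 2 := mul_le_of_le_one_right (by positivity) hz.1
    have hlim : Tendsto (fun ε : ℝ => (1 - t * v) * ((1 - ε) + t * ((1 - ε) ^ 2 - ε)))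
        (𝓝[>] 0) (𝓝 ((1 - t * v) * ((1 - 0) + t * ((1 - 0) ^ 2 - 0)))) :=
      (Continuous.tendsto (by fun_prop) 0).mono_left nhdsWithin_le_nhds
    have := le_of_tendsto hlim (by
      filter_upwards [Ioo_mem_nhdsGT one_pos] with ε hε
      exact main ε hε.1 hε.2)
    simpa using this
  by_contra! hlt
  -- The inequality reduces to `1 - v ≤ t (1 + v) ≤ 2t`, which fails for `t = (1 - v)/4`.
  have := key ((1 - v) / 4) (by linarith) (by linarith)
  nlinarith

theorem IsLush.numericalIndex_eq_one [Nontrivial X] (h : IsLush 𝕜 X) :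
    numericalIndex 𝕜 X = 1 := by
  have hset : {r | ∃ T : X →L[𝕜] X, ‖T‖ = 1 ∧ r = numericalRadius T} = {1} := by
    ext r
    constructor
    · rintro ⟨T, hT, rfl⟩
      exact le_antisymm (hT ▸ numericalRadius_le_norm T) (h.one_le_numericalRadius hT)
    · rintro rfl
      have hid : ‖ContinuousLinearMap.id 𝕜 X‖ = 1 := ContinuousLinearMap.norm_id
      exact ⟨_, hid, le_antisymm (h.one_le_numericalRadius hid)
        (hid ▸ numericalRadius_le_norm _)⟩
  rw [numericalIndex, hset, csInf_singleton]

end index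

open MeasureTheory

/-! ### Strictly convex norms on `C[0, 1]` -/

section step

variable (𝕜 : Type) [RCLike 𝕜]

theorem isStrictlyConvex_of_innerProductSpace (H : Type*) [NormedAddCommGroup H]
    [InnerProductSpace 𝕜 H] : IsStrictlyConvex 𝕜 H := by
  have : UniformConvexSpace H := by
    let : InnerProductSpace ℝ H := InnerProductSpace.rclikeToReal 𝕜 H
    infer_instance
  let : NormedSpace ℝ H := NormedSpace.restrictScalars ℝ 𝕜 H
  exact (inferInstance : StrictConvexSpace ℝ H)

/-- Full support of the measure makes the map from `C[0,1]` to `L²` injective. -/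
theorem isOpenPosMeasure_unitInterval : (volume : Measure unitInterval).IsOpenPosMeasure := by
  refine ⟨fun U hU hne => ?_⟩
  obtain ⟨V, hV, rfl⟩ := isOpen_induced_iff.1 hU
  rw [unitInterval.volume_apply, Subtype.image_preimage_coe]
  obtain ⟨x, hx⟩ := hne
  have hcl : (x : ℝ) ∈ closure (Set.Ioo (0 : ℝ) 1) := by
    rw [closure_Ioo zero_ne_one]
    exact x.2
  have hpos := (hV.inter isOpen_Ioo).measure_pos volume (mem_closure_iff.1 hcl V hV hx)
  have hsub : V ∩ Set.Ioo (0 : ℝ) 1 ⊆ Set.Icc 0 1 ∩ V := fun t ht =>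
    ⟨Set.Ioo_subset_Icc_self ht.2, ht.1⟩
  exact (hpos.trans_le (measure_mono hsub)).ne'

theorem norm_toLp_unitInterval_le (f : C(unitInterval, 𝕜)) :
    ‖ContinuousMap.toLp (E := 𝕜) 2 (volume : Measure unitInterval) 𝕜 f‖ ≤ ‖f‖ := by
  have h := (ContinuousMap.toLp (E := 𝕜) 2 (volume : Measure unitInterval) 𝕜).le_of_opNorm_le
    (ContinuousMap.toLp_norm_le (E := 𝕜) (𝕜 := 𝕜) (p := 2) (volume : Measure unitInterval)) f
  simpa [measureUnivNNReal] using h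

/-- The functions `1` and `t` both peak at `1`. This is why a strictly convex space always embeds as
a proper subspace. -/
theorem not_isStrictlyConvex_unitInterval :
    ¬ IsStrictlyConvex 𝕜 (ULift.{u} C(unitInterval, 𝕜)) := by
  intro h
  let g : C(unitInterval, 𝕜) := ⟨fun t => ((t : ℝ) : 𝕜), by fun_prop⟩
  have hg : ‖g‖ = 1 := by
    refine le_antisymm ((ContinuousMap.norm_le _ zero_le_one).2 fun t => ?_) ?_
    · change ‖((t : ℝ) : 𝕜)‖ ≤ 1
      rw [RCLike.norm_of_nonneg t.2.1]
      exact t.2.2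
    · simpa [g] using g.norm_coe_le_norm 1
  have h1 : ‖(1 : C(unitInterval, 𝕜))‖ = 1 := norm_one
  have h2 : ‖1 + g‖ = 2 := by
    refine le_antisymm ((norm_add_le _ _).trans (by rw [h1, hg]; norm_num)) ?_
    have h3 := (1 + g).norm_coe_le_norm 1
    have h4 : (1 + g) 1 = 2 := by simp [g, one_add_one_eq_two]
    rwa [h4, RCLike.norm_ofNat] at h3
  have h5 : ULift.up.{u} (1 : C(unitInterval, 𝕜)) = ULift.up g :=
    h.eq_of_norm_add (h1.trans hg.symm) (by
      change ‖1 + g‖ = ‖(1 : C(unitInterval, 𝕜))‖ + ‖g‖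
      rw [h1, hg, h2]; norm_num)
  have h6 := DFunLike.congr_fun (ULift.up_injective h5) 0
  simp [g] at h6

variable {𝕜}

/-- The identity as an isomorphism between `E` and `E` with an equivalent norm. -/
def WithNorm.equivOfBounds {E : Type*} [NormedAddCommGroup E] [NormedSpace 𝕜 E]
    (q : LinearNorm 𝕜 E) (C : ℝ) (h : ∀ x, ‖x‖ ≤ q.toSeminorm x ∧ q.toSeminorm x ≤ C * ‖x‖) :
    E ≃L[𝕜] WithNorm q :=
  let e : E ≃ₗ[𝕜] WithNorm q := LinearEquiv.refl 𝕜 E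
  e.toContinuousLinearEquivOfBounds C 1 (fun x => (h x).2)
    (fun x => (h x).1.trans_eq (one_mul _).symm)

theorem IsStrictlyConvex.of_linearIsometryEquiv {X Z : Type*} [NormedAddCommGroup X]
    [NormedSpace 𝕜 X] [NormedAddCommGroup Z] [NormedSpace 𝕜 Z] (e : X ≃ₗᵢ[𝕜] Z)
    (h : IsStrictlyConvex 𝕜 Z) : IsStrictlyConvex 𝕜 X := by
  refine isStrictlyConvex_of_norm_add_ne_two fun x y hx hy hxy => e.injective ?_
  refine h.eq_of_norm_add ?_ ?_
  · rw [e.norm_map, e.norm_map, hx, hy]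
  · rw [← map_add, e.norm_map, e.norm_map, e.norm_map, hx, hy, hxy]; norm_num

/-- A norm on `C[0, 1]` that is strictly convex, complete and separable. -/
def IsRotundNorm (q : LinearNorm 𝕜 (ULift.{u} C(unitInterval, 𝕜))) : Prop :=
  IsStrictlyConvex 𝕜 (WithNorm q) ∧ CompleteSpace (WithNorm q) ∧
    TopologicalSpace.SeparableSpace (WithNorm q)

/-- Every strictly convex separable Banach space embeds as a proper subspace into `C[0, 1]` with a
strictly convex norm that is close to the supremum norm. -/
theorem exists_rotundNorm_extension (Y : Type u) [NormedAddCommGroup Y] [NormedSpace 𝕜 Y]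
    [CompleteSpace Y] [TopologicalSpace.SeparableSpace Y] (hY : IsStrictlyConvex 𝕜 Y)
    {δ : ℝ} (hδ : 0 < δ) :
    ∃ q : LinearNorm 𝕜 (ULift.{u} C(unitInterval, 𝕜)), IsRotundNorm q ∧
      (∀ x, ‖x‖ ≤ q.toSeminorm x ∧ q.toSeminorm x ≤ (1 + δ) * ‖x‖) ∧
      ∃ J : Y →ₗᵢ[𝕜] WithNorm q, ¬ Function.Surjective J := by
  have := isOpenPosMeasure_unitInterval
  obtain ⟨j₀⟩ := exists_isometry_unitInterval 𝕜 Y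
  let up : ULift.{u} C(unitInterval, 𝕜) ≃ₗᵢ[𝕜] C(unitInterval, 𝕜) := LinearIsometryEquiv.ulift 𝕜 _
  let j : Y →ₗᵢ[𝕜] ULift.{u} C(unitInterval, 𝕜) := up.symm.toLinearIsometry.comp j₀
  let K := LinearMap.range j.toLinearMap
  have hK : IsClosed (K : Set (ULift.{u} C(unitInterval, 𝕜))) :=
    j.isometry.isClosedEmbedding.isClosed_range
  have hKs : IsStrictlyConvex 𝕜 K := IsStrictlyConvex.of_linearIsometryEquiv j.equivRange.symm hY
  obtain ⟨q, hqK, hq, hqs⟩ := exists_strictlyConvex_extension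
    (isStrictlyConvex_of_innerProductSpace 𝕜 (Lp 𝕜 2 (volume : Measure unitInterval)))
    ((ContinuousMap.toLp (E := 𝕜) 2 (volume : Measure unitInterval) 𝕜).toLinearMap ∘ₗ
      up.toLinearEquiv.toLinearMap)
    (fun x => (norm_toLp_unitInterval_le 𝕜 (up x)).trans_eq (up.norm_map x))
    ((ContinuousMap.toLp_injective (volume : Measure unitInterval)).comp up.injective)
    K hK hKs hδ
  let e := WithNorm.equivOfBounds q (1 + δ) hq
  refine ⟨q, ⟨hqs, ?_, ?_⟩, hq, ⟨⟨e.toLinearEquiv.toLinearMap ∘ₗ j.toLinearMap, fun y => ?_⟩, ?_⟩⟩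
  · exact (completeSpace_congr (e := e.toEquiv) e.isUniformEmbedding).1 inferInstance
  · have : TopologicalSpace.SeparableSpace (ULift.{u} C(unitInterval, 𝕜)) :=
      up.symm.surjective.denseRange.separableSpace up.symm.continuous
    exact e.surjective.denseRange.separableSpace e.continuous
  · exact (hqK (j y) ⟨y, rfl⟩).trans (j.norm_map y)
  · intro hsurj
    have hj : Function.Surjective j := fun x => hsurj x
    exact not_isStrictlyConvex_unitInterval 𝕜
      (IsStrictlyConvex.of_linearIsometryEquiv (LinearIsometryEquiv.ofSurjective j hj).symm hY)

/-- A chain of strictly convex Banach spaces that start with `Y₀` and approach `C[0, 1]`. -/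
theorem exists_rotundNorm_chain (Y₀ : Type u) [NormedAddCommGroup Y₀] [NormedSpace 𝕜 Y₀]
    [CompleteSpace Y₀] [TopologicalSpace.SeparableSpace Y₀] (hY₀ : IsStrictlyConvex 𝕜 Y₀) :
    ∃ (q : ℕ → LinearNorm 𝕜 (ULift.{u} C(unitInterval, 𝕜)))
      (J : ∀ n, WithNorm (q n) →ₗᵢ[𝕜] WithNorm (q (n + 1))),
      (∀ n, IsRotundNorm (q n)) ∧
      (∀ n x, ‖x‖ ≤ (q n).toSeminorm x ∧
        (q n).toSeminorm x ≤ (1 + 1 / ((n : ℝ) + 1)) * ‖x‖) ∧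
      (∀ n, ¬ Function.Surjective (J n)) ∧ Nonempty (Y₀ →ₗᵢ[𝕜] WithNorm (q 0)) := by
  -- The constant `1` is `1/(n+1)` at `n = 0`; the step out of stage `n` below uses `1/(n+2)`, as
  -- stage `n + 1` requires.
  obtain ⟨q₀, hq₀, hb₀, J₀, -⟩ := exists_rotundNorm_extension Y₀ hY₀ one_pos
  have step : ∀ (s : {q : LinearNorm 𝕜 (ULift.{u} C(unitInterval, 𝕜)) // IsRotundNorm q}) (n : ℕ),
      ∃ s' : {q : LinearNorm 𝕜 (ULift.{u} C(unitInterval, 𝕜)) // IsRotundNorm q},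
        (∀ x, ‖x‖ ≤ s'.1.toSeminorm x ∧
          s'.1.toSeminorm x ≤ (1 + 1 / (((n + 1 : ℕ) : ℝ) + 1)) * ‖x‖) ∧
        ∃ J : WithNorm s.1 →ₗᵢ[𝕜] WithNorm s'.1, ¬ Function.Surjective J := by
    rintro ⟨q, hs, hc, hsep⟩ n
    obtain ⟨q', h1, h2, h3⟩ := exists_rotundNorm_extension (WithNorm q) hs
      (δ := 1 / (((n + 1 : ℕ) : ℝ) + 1)) (by positivity)
    exact ⟨⟨q', h1⟩, h2, h3⟩
  choose next hb J hJ using step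
  let s : ℕ → {q : LinearNorm 𝕜 (ULift.{u} C(unitInterval, 𝕜)) // IsRotundNorm q} := fun n =>
    Nat.rec ⟨q₀, hq₀⟩ (fun n s => next s n) n
  refine ⟨fun n => (s n).1, fun n => J (s n) n, fun n => (s n).2, fun n => ?_,
    fun n => hJ (s n) n, ⟨J₀⟩⟩
  cases n with
  | zero =>
    intro x
    have h1 : (1 : ℝ) / (((0 : ℕ) : ℝ) + 1) = 1 := by norm_num
    rw [h1]
    exact hb₀ x
  | succ n => exact hb (s n) n

end step

/-! ### Transfer of stable C-properties -/

/-- A subspace onto which `C[0, 1]` maps almost isometrically has almost isometrically every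
stable C-property. -/
theorem SpaceProperty.IsStableC.exists_holds_range {𝕜 : Type} [RCLike 𝕜]
    {P : SpaceProperty.{u} 𝕜} (hP : P.IsStableC) {X : Type u} [NormedAddCommGroup X]
    [NormedSpace 𝕜 X] (i : ULift.{u} C(unitInterval, 𝕜) →ₗ[𝕜] X) {ε : ℝ} (hε : 0 < ε)
    (hi : ∀ u, ‖u‖ ≤ ‖i u‖ ∧ ‖i u‖ ≤ (1 + ε) * ‖u‖) :
    ∃ p : LinearNorm 𝕜 (LinearMap.range i), p.IsEpsEquivalent ε ∧ P.Holds (WithNorm p) := by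
  have hinj : Function.Injective i := (injective_iff_map_eq_zero i).2 fun u hu => by
    have := (hi u).1
    rw [hu, norm_zero] at this
    exact norm_le_zero_iff.1 this
  let e := LinearEquiv.ofInjective i hinj
  -- The supremum norm carried over to the range, which thereby becomes isometric to `C[0,1]`.
  let p : LinearNorm 𝕜 (LinearMap.range i) :=
    { (normSeminorm 𝕜 (ULift.{u} C(unitInterval, 𝕜))).comp e.symm.toLinearMap with
      eq_zero_of_map_eq_zero := fun x hx => by
        have : ‖e.symm x‖ = 0 := hx
        simpa using this }
  have hp : ∀ u, p.toSeminorm (e u) = ‖u‖ := fun u => by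
    change ‖e.symm (e u)‖ = ‖u‖
    rw [e.symm_apply_apply]
  refine ⟨p, fun w => ?_, ?_⟩
  · obtain ⟨u, rfl⟩ := e.surjective w
    have hn : ‖e u‖ = ‖i u‖ := rfl
    rw [hp, hn]
    constructor
    · rw [one_div, inv_mul_le_iff₀ (by positivity)]
      exact (hi u).2
    · exact (hi u).1.trans (le_mul_of_one_le_left (norm_nonneg _) (by linarith))
  · let e' : ULift.{u} C(unitInterval, 𝕜) ≃ₗ[𝕜] WithNorm p := e
    exact P.of_isometry _ _ ⟨e', hp⟩ hP.holds_C

end NormedGeom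
end

/-! ### The main theorem -/

theorem theorem3p2 {𝕜 : Type} [RCLike 𝕜] (Y₀ : Type u) [NormedAddCommGroup Y₀]
    [NormedSpace 𝕜 Y₀] [CompleteSpace Y₀] [TopologicalSpace.SeparableSpace Y₀]
    (hY₀ : NormedGeom.IsStrictlyConvex 𝕜 Y₀) :
    ∃ (X : Type u) (_ : NormedAddCommGroup X) (_ : NormedSpace 𝕜 X),
      Nonempty (Y₀ →ₗᵢ[𝕜] X) ∧
      NormedGeom.IsStrictlyConvex 𝕜 X ∧
      TopologicalSpace.SeparableSpace X ∧
      ¬ CompleteSpace X ∧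
      (∀ P : NormedGeom.SpaceProperty.{u} 𝕜, P.IsStableC → P.Holds X) ∧
      NormedGeom.IsLush 𝕜 X ∧
      NormedGeom.numericalIndex 𝕜 X = 1 := by
  open NormedGeom in
  obtain ⟨q, J, hq, hb, hJ, ⟨J₀⟩⟩ := exists_rotundNorm_chain Y₀ hY₀
  obtain ⟨X, _, _, i, hi, hsurj⟩ := exists_union_of_chain J
  have hcomplete : ∀ n, CompleteSpace (WithNorm (q n)) := fun n => (hq n).2.1
  have hseparable : ∀ n, TopologicalSpace.SeparableSpace (WithNorm (q n)) := fun n => (hq n).2.2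
  -- The source of `L n` carries the supremum norm, so `L n` is only almost isometric, with
  -- distortion at most `1 + 1/(n+1)`.
  let L : ∀ n, ULift.{u} C(unitInterval, 𝕜) →ₗ[𝕜] X := fun n =>
    (i n).toLinearMap ∘ₗ (WithNorm.equivOfBounds (q n) _ (hb n)).toLinearEquiv.toLinearMap
  have hL : ∀ n u, ‖L n u‖ = (q n).toSeminorm u := fun n u => (i n).norm_map _
  have hLrange : ∀ (F : Finset X) (ε : ℝ), 0 < ε → ∃ n,
      (∀ x ∈ F, x ∈ LinearMap.range (L n)) ∧ ∀ u, ‖u‖ ≤ ‖L n u‖ ∧ ‖L n u‖ ≤ (1 + ε) * ‖u‖ := by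
    intro F ε hε
    obtain ⟨N, hN⟩ := exists_nat_one_div_lt hε
    obtain ⟨n, hn, hF⟩ := exists_finset_subset_range hi hsurj F N
    refine ⟨n, fun x hx => ?_, fun u => ?_⟩
    · obtain ⟨u, hu⟩ := hF x hx
      exact ⟨u, hu⟩
    · rw [hL]
      refine ⟨(hb n u).1, (hb n u).2.trans ?_⟩
      have : 1 / ((n : ℝ) + 1) ≤ 1 / ((N : ℝ) + 1) := by gcongr
      gcongr
      exact this.trans hN.le
  have hlush : IsLush 𝕜 X := by
    classical
    refine isLush_of_locally_unitInterval fun δ hδ x y => ?_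
    obtain ⟨n, hF, hn⟩ := hLrange {x, y} δ hδ
    obtain ⟨g, hg⟩ := hF x (by simp)
    obtain ⟨k, hk⟩ := hF y (by simp)
    exact ⟨L n ∘ₗ (ULift.moduleEquiv (R := 𝕜)).symm.toLinearMap, fun u => hn (ULift.up u),
      ⟨g.down, hg⟩, ⟨k.down, hk⟩⟩
  have hnontrivial : Nontrivial X := by
    refine ⟨⟨L 0 (ULift.up 1), 0, fun h => ?_⟩⟩
    have h1 := (hb 0 (ULift.up 1)).1
    rw [← hL, h, norm_zero] at h1
    have h2 : ‖(1 : C(unitInterval, 𝕜))‖ ≤ 0 := h1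
    rw [norm_one] at h2
    exact absurd h2 (by norm_num)
  refine ⟨X, inferInstance, inferInstance, ⟨(i 0).comp J₀⟩,
    isStrictlyConvex_union hi hsurj fun n => (hq n).1, separableSpace_union hsurj,
    not_completeSpace_union hi hsurj hJ, fun P hP => hP.stable X fun ε hε F => ?_,
    hlush, hlush.numericalIndex_eq_one⟩
  obtain ⟨n, hF, hn⟩ := hLrange F ε hε
  exact ⟨LinearMap.range (L n), hF, hP.exists_holds_range (L n) hε hn⟩
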